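/- Let $p$ be an odd prime, $\mathbb{C}_p$ the completion of an algebraic closure of $\mathbb{Q}_p$ with $|p|_p=1/p$, and fix an embedding $\iota$ of the field of algebraic numbers into $\mathbb{C}_p$. For $r\in\mathbb{Q}$ let $p^r\in\mathbb{C}_p$ be the image under $\iota$ of the positive real number $p^r$. For $a\in\mathbb{C}_p^\times$ let $v_p(a)\in\mathbb{Q}$ be given by $|a|_p=p^{-v_p(a)}$, let $\hat a$ be the root of unity of order prime to $p$ with $|a/p^{v_p(a)}-\hat a|_p<1$, and put $$\omega_v(a)=p^{v_p(a)}\hat a,\qquad \langle a\rangle=a/\omega_v(a),\qquad \langle a\rangle^{s}=\sum_{n\ge0}\binom sn(\langle a\rangle-1)^n .$$ For $f:\mathbb{Z}_p\to\mathbb{C}_p$ put $\int_{\mathbb{Z}_p}f\,d\mu_{-1}=\lim_{r\to\infty}\sum_{k=0}^{p^r-1}f(k)(-1)^k$ when the limit exists, and let $\zeta_{p,E}(s,a)=\int_{\mathbb{Z}_p}\langle a+t\rangle^{1-s}\,d\mu_{-1}(t)$. For $t\in\mathbb{Z}_p$ let $\exp_p(tD)$ be the unique continuous $\mathbb{C}_p$-linear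 operator on $C(\mathbb{Z}_p,\mathbb{C}_p)$ (with the supremum norm) that is given on polynomial functions by $\exp_p(tD)=\mathrm{id}+\sum_{k\ge1}\frac{t^k}{k!}D_s^k$, $D_s=\partial/\partial s$. Let $$T_p^a=\sum_{n=0}^\infty P_{p,n}^a(s)\exp_p(nD),\qquad P_{p,0}^a(s)=\frac{2}{s-1},\quad P_{p,1}^a(s)=\frac1{\omega_v(a)},\quad P_{p,n}^a(s)=\frac{1}{n!\,\omega_v^n(a)}\prod_{j=1}^{n-1}(s-1+j)\ \ (n\ge2).$$ **Theorem.** Let $a\in\mathbb{C}_p$ with $|a|_p>1$. The limit defining $\zeta_{p,E}(s,a)$ exists for every $s\in\mathbb{Z}_p$, and $F(s)=\zeta_{p,E}(s,a)-\langle a\rangle^{1-s}$ is a continuous function on $\mathbb{Z}_p$ with the following properties. 1. For every $s\in\mathbb{Z}_p$ with $s\ne1$ the series $T_p^a[F](s)$ converges, and $$T_p^a\left[\zeta_{p,E}(s,a)-\langle a\rangle^{1-s}\right]=\frac1{s-1}\left(\langle a-1\rangle^{1-s}-\langle a\rangle^{1-s}\right).$$ 2. $F$ is $C^\infty$ on $\mathbb{Z}_p$,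 and for every $s\in\mathbb{Z}_p$ there is an $m\ge0$ such that $\sum_{k\ge0}\frac{t^k}{k!}D_s^kF(s)$ converges to $\exp_p(tD)F(s)$ for all $t\in p^m\mathbb{Z}_p$. 3. If $a$ lies in a finite extension $K\subset\mathbb{C}_p$ of $\mathbb{Q}_p$ with ramification index less than $p-1$, then for all $s\in\mathbb{Z}_p$ and all integers $n\ge0$ the series $\sum_{k\ge0}\frac{n^k}{k!}D_s^kF(s)$ converges to $\exp_p(nD)F(s)$, so that the equation in 1 then holds with $\exp_p(nD)$ read as this convergent series of derivatives. -/

import Mathlib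

open Filter Topology Polynomial

noncomputable section

namespace PadicVanGorder

/-! ## The projections attached to an embedding of the algebraic numbers into `ℂ_[p]` -/

/-- The positive real rational power `p ^ r` is an algebraic number. -/
theorem rpow_mem_algebraicClosure (p : ℕ) (r : ℚ) :
    (((p : ℝ) ^ (r : ℝ) : ℝ) : ℂ) ∈ algebraicClosure ℚ ℂ := by
  rw [mem_algebraicClosure_iff]
  have hp0 : (0 : ℝ) ≤ (p : ℝ) := Nat.cast_nonneg p
  have key : ((((p : ℝ) ^ (r : ℝ) : ℝ) : ℂ)) ^ r.den = ((p : ℚ) ^ r.num : ℚ) := by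
    rw [← Complex.ofReal_pow, ← Real.rpow_natCast, ← Real.rpow_mul hp0]
    have h : (r : ℝ) * (r.den : ℝ) = ((r.num : ℤ) : ℝ) := by
      exact_mod_cast Rat.mul_den_eq_num r
    rw [h, Real.rpow_intCast]
    push_cast
    rfl
  refine IsAlgebraic.of_pow r.den_pos ?_
  rw [key]
  exact isAlgebraic_algebraMap (R := ℚ) (A := ℂ) ((p : ℚ) ^ r.num)

variable {p : ℕ} [Fact p.Prime]

/-- The image in `ℂ_[p]` of the positive real number `p ^ r`, `r ∈ ℚ`, under the fixed embedding
`ι` of the field of algebraic numbers. -/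
def ratPow (ι : algebraicClosure ℚ ℂ →+* ℂ_[p]) (r : ℚ) : ℂ_[p] :=
  ι ⟨(((p : ℝ) ^ (r : ℝ) : ℝ) : ℂ), rpow_mem_algebraicClosure p r⟩

open Classical in
/-- The valuation `v_p` on `ℂ_[p]ˣ`, normalised by `v_p(p) = 1`, with values in `ℚ`:
`‖a‖ = p ^ (-v_p(a))`. -/
def vp (a : ℂ_[p]) : ℚ :=
  if h : ∃ r : ℚ, ‖a‖ = (p : ℝ) ^ (-(r : ℝ)) then h.choose else 0

/-- `ζ` is a root of unity whose order is not divisible by `p`. -/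
def IsPrimeToPRootOfUnity (ζ : ℂ_[p]) : Prop :=
  ∃ m : ℕ, 0 < m ∧ ¬ p ∣ m ∧ ζ ^ m = 1

open Classical in
/-- The Teichmüller representative of an element `u` with `‖u‖ = 1`: the root of unity `ζ` of
order prime to `p` with `‖u - ζ‖ < 1`. -/
def teichUnit (u : ℂ_[p]) : ℂ_[p] :=
  if h : ∃ ζ : ℂ_[p], IsPrimeToPRootOfUnity ζ ∧ ‖u - ζ‖ < 1 then h.choose else 1

/-- `â` for `a ≠ 0`: the Teichmüller representative of `a / p ^ (v_p(a))`. -/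
def teich (ι : algebraicClosure ℚ ℂ →+* ℂ_[p]) (a : ℂ_[p]) : ℂ_[p] :=
  teichUnit (a / ratPow ι (vp a))

/-- `ω_v(a) = p ^ (v_p(a)) â`. -/
def omegaV (ι : algebraicClosure ℚ ℂ →+* ℂ_[p]) (a : ℂ_[p]) : ℂ_[p] :=
  ratPow ι (vp a) * teich ι a

/-- `⟨a⟩ = p ^ (-v_p(a)) a / â`. -/
def angle (ι : algebraicClosure ℚ ℂ →+* ℂ_[p]) (a : ℂ_[p]) : ℂ_[p] :=
  ratPow ι (-vp a) * a / teich ι a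

/-- `⟨a⟩ ^ s = ∑ n, (s choose n) (⟨a⟩ - 1) ^ n`. -/
def anglePow (ι : algebraicClosure ℚ ℂ →+* ℂ_[p]) (a s : ℂ_[p]) : ℂ_[p] :=
  ∑' n : ℕ, (∏ i ∈ Finset.range n, (s - i)) / (n.factorial : ℂ_[p]) * (angle ι a - 1) ^ n

/-! ## The fermionic integral and the zeta function -/

/-- The inclusion `ℤ_[p] ⊆ ℂ_[p]`. -/
def toC (s : ℤ_[p]) : ℂ_[p] := algebraMap ℚ_[p] ℂ_[p] (s : ℚ_[p])

/-- The sums `∑_{k < p ^ r} f(k) (-1) ^ k`. -/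
def fermionicSum (f : ℤ_[p] → ℂ_[p]) (r : ℕ) : ℂ_[p] :=
  ∑ k ∈ Finset.range (p ^ r), f (k : ℤ_[p]) * (-1) ^ k

/-- `f` has fermionic `p`-adic integral `I`. -/
def HasFermionicIntegral (f : ℤ_[p] → ℂ_[p]) (I : ℂ_[p]) : Prop :=
  Tendsto (fermionicSum f) atTop (𝓝 I)

/-- The fermionic `p`-adic integral of `f` over `ℤ_[p]`. -/
def fermionicIntegral (f : ℤ_[p] → ℂ_[p]) : ℂ_[p] :=
  limUnder atTop (fermionicSum f)

/-- The `p`-adic Hurwitz-type Euler zeta function `ζ_{p,E}(s, a)`. -/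
def zetaE (ι : algebraicClosure ℚ ℂ →+* ℂ_[p]) (s a : ℂ_[p]) : ℂ_[p] :=
  fermionicIntegral fun t => anglePow ι (a + toC t) (1 - s)

/-! ## The operators `exp_p(tD)` -/

theorem continuous_toC : Continuous (toC : ℤ_[p] → ℂ_[p]) :=
  (algebraMapCLM ℚ_[p] ℂ_[p]).continuous.comp continuous_subtype_val

/-- The polynomial function on `ℤ_[p]` given by `q`. -/
def polyFun (q : ℂ_[p][X]) : C(ℤ_[p], ℂ_[p]) :=
  ⟨fun s => q.eval (toC s), q.continuous.comp continuous_toC⟩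

/-- `exp_p(tD) q = q + ∑_{k ≥ 1} (t ^ k / k!) D ^ k q` for a polynomial `q`
(all terms with `k > deg q` vanish). -/
def expDPoly (t : ℤ_[p]) (q : ℂ_[p][X]) : ℂ_[p][X] :=
  ∑ k ∈ Finset.range (q.natDegree + 1),
    C (toC t ^ k / (k.factorial : ℂ_[p])) * derivative^[k] q

/-- `E` is a continuous linear operator on `C(ℤ_[p], ℂ_[p])` that is given on polynomial functions
by the exponential series in `tD`. -/
def IsExpD (t : ℤ_[p]) (E : C(ℤ_[p], ℂ_[p]) →L[ℂ_[p]] C(ℤ_[p], ℂ_[p])) : Prop :=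
  ∀ q : ℂ_[p][X], E (polyFun q) = polyFun (expDPoly t q)

theorem toC_add (s t : ℤ_[p]) : toC (s + t) = toC s + toC t := by
  simp [toC]

theorem expDPoly_eval (t : ℤ_[p]) (q : ℂ_[p][X]) (x : ℂ_[p]) :
    (expDPoly t q).eval x = q.eval (x + toC t) := by
  rw [expDPoly, add_comm x, ← taylor_eval, eval_finsetSum,
    eval_eq_sum_range' (n := q.natDegree + 1) (by rw [natDegree_taylor]; exact Nat.lt_succ_self _)]
  refine Finset.sum_congr rfl fun k _ => ?_
  rw [taylor_coeff, eval_mul, eval_C, ← factorial_smul_hasseDeriv]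
  have : ((k.factorial : ℕ) : ℂ_[p]) ≠ 0 := Nat.cast_ne_zero.mpr k.factorial_ne_zero
  have h : (k.factorial • hasseDeriv k) q = (k.factorial : ℂ_[p][X]) * hasseDeriv k q := by
    rw [LinearMap.smul_apply, nsmul_eq_mul]
  rw [h, eval_mul, eval_natCast]
  field_simp

/-- A continuous function on `ℤ_[p]` with values in a complete ultrametric extension `L` of `ℚ_[p]`
is a uniform limit of polynomial functions. -/
theorem mem_closure_polynomial {L : Type*} [NormedField L] [NormedAlgebra ℚ_[p] L]
    [IsUltrametricDist L] [CompleteSpace L] (f : C(ℤ_[p], L)) :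
    f ∈ closure {g : C(ℤ_[p], L) |
      ∃ q : L[X], ∀ x : ℤ_[p], g x = q.eval (algebraMap ℚ_[p] L (x : ℚ_[p]))} := by
  let _ : Algebra ℤ_[p] L :=
    ((algebraMap ℚ_[p] L).comp (algebraMap ℤ_[p] ℚ_[p])).toAlgebra
  have hmap : ∀ x : ℤ_[p], algebraMap ℤ_[p] L x = algebraMap ℚ_[p] L (x : ℚ_[p]) := fun _ => rfl
  have : CharZero L :=
    (RingHom.charZero_iff (algebraMap ℚ_[p] L).injective).mp inferInstance
  have : IsBoundedSMul ℤ_[p] L := by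
    refine IsBoundedSMul.of_norm_smul_le fun x y => ?_
    rw [Algebra.smul_def, norm_mul, hmap, norm_algebraMap']
    rfl
  refine mem_closure_of_tendsto (PadicInt.hasSum_mahler f) (Eventually.of_forall fun s => ?_)
  refine ⟨∑ n ∈ s, C ((fwdDiff 1)^[n] f 0 / (n.factorial : L)) * descPochhammer L n, fun x => ?_⟩
  rw [ContinuousMap.sum_apply, eval_finsetSum]
  refine Finset.sum_congr rfl fun n _ => ?_
  have hn : ((n.factorial : ℕ) : L) ≠ 0 := Nat.cast_ne_zero.mpr n.factorial_ne_zero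
  have h1 : (descPochhammer L n).eval (algebraMap ℤ_[p] L x) =
      (n.factorial : L) * algebraMap ℤ_[p] L (Ring.choose x n) := by
    have h2 := congrArg (algebraMap ℤ_[p] L) (Ring.descPochhammer_eq_factorial_smul_choose x n)
    rw [nsmul_eq_mul, map_mul, map_natCast] at h2
    rw [← h2, ← descPochhammer_map (algebraMap ℤ_[p] L) n, eval_map_algebraMap,
      aeval_algebraMap_apply_eq_algebraMap_eval, descPochhammer_eval_eq_ascPochhammer,
      Polynomial.descPochhammer_smeval_eq_ascPochhammer, Polynomial.ascPochhammer_smeval_eq_eval]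
  rw [PadicInt.mahlerTerm_apply, Algebra.smul_def, mahler_apply, ← hmap, eval_mul, eval_C, h1]
  field_simp

/-- Polynomial functions are dense in `C(ℤ_[p], ℂ_[p])`. -/
theorem denseRange_polyFun : DenseRange (polyFun : ℂ_[p][X] → C(ℤ_[p], ℂ_[p])) := by
  intro f
  refine closure_mono ?_ (mem_closure_polynomial f)
  rintro g ⟨q, hq⟩
  exact ⟨q, ContinuousMap.ext fun x => (hq x).symm⟩

/-- There is exactly one such operator. -/
theorem existsUnique_isExpD (t : ℤ_[p]) :
    ∃! E : C(ℤ_[p], ℂ_[p]) →L[ℂ_[p]] C(ℤ_[p], ℂ_[p]), IsExpD t E := by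
  let S : C(ℤ_[p], ℂ_[p]) →L[ℂ_[p]] C(ℤ_[p], ℂ_[p]) :=
    ⟨(ContinuousMap.compRightAlgHom ℂ_[p] ℂ_[p]
      (⟨fun s => s + t, by fun_prop⟩ : C(ℤ_[p], ℤ_[p]))).toLinearMap,
      ContinuousMap.continuous_precomp _⟩
  have hS : IsExpD t S := fun q => by
    ext s
    change q.eval (toC (s + t)) = (expDPoly t q).eval (toC s)
    rw [expDPoly_eval, toC_add]
  refine ⟨S, hS, fun E hE => ContinuousLinearMap.ext fun f => congrFun ?_ f⟩
  refine denseRange_polyFun.equalizer E.continuous S.continuous (funext fun q => ?_)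
  exact (hE q).trans (hS q).symm

/-- `exp_p(tD)`: the unique continuous linear operator on `C(ℤ_[p], ℂ_[p])` that is given on
polynomial functions by the exponential series in `tD`. -/
def expD (t : ℤ_[p]) : C(ℤ_[p], ℂ_[p]) →L[ℂ_[p]] C(ℤ_[p], ℂ_[p]) :=
  (existsUnique_isExpD t).choose

open Classical in
/-- The extension by zero to `ℚ_[p]` of a function on the open and closed subset `ℤ_[p]`. -/
def extendZero (f : ℤ_[p] → ℂ_[p]) (x : ℚ_[p]) : ℂ_[p] :=
  if h : ‖x‖ ≤ 1 then f ⟨x, h⟩ else 0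

/-- `D_s ^ k f`, the `k`-th derivative of a function of `s ∈ ℤ_[p]`. -/
def iterD (k : ℕ) (f : ℤ_[p] → ℂ_[p]) (s : ℤ_[p]) : ℂ_[p] :=
  iteratedDeriv k (extendZero f) (s : ℚ_[p])

/-- The `k`-th term `(t ^ k / k!) D_s ^ k f` of the exponential series `exp_p(tD) f` at `s`. -/
def expDTerm (t : ℤ_[p]) (f : ℤ_[p] → ℂ_[p]) (s : ℤ_[p]) (k : ℕ) : ℂ_[p] :=
  toC t ^ k / (k.factorial : ℂ_[p]) * iterD k f s

/-! ## The `p`-adic Van Gorder operator -/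

/-- The coefficients `P_{p,n}^a(s)`. -/
def coeffP (ι : algebraicClosure ℚ ℂ →+* ℂ_[p]) (a : ℂ_[p]) (n : ℕ) (s : ℂ_[p]) : ℂ_[p] :=
  if n = 0 then 2 / (s - 1)
  else if n = 1 then 1 / omegaV ι a
  else 1 / ((n.factorial : ℂ_[p]) * omegaV ι a ^ n) * ∏ j ∈ Finset.Icc 1 (n - 1), (s - 1 + j)

/-- `L_{p,n}^a = P_{p,n}^a(s) exp_p(nD)`, applied to `f` and evaluated at `s`. -/
def opL (ι : algebraicClosure ℚ ℂ →+* ℂ_[p]) (a : ℂ_[p]) (n : ℕ) (f : C(ℤ_[p], ℂ_[p]))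
    (s : ℤ_[p]) : ℂ_[p] :=
  coeffP ι a n (toC s) * expD (n : ℤ_[p]) f s

/-- `T_p^a = ∑ n, L_{p,n}^a`, applied to `f` and evaluated at `s`. -/
def opT (ι : algebraicClosure ℚ ℂ →+* ℂ_[p]) (a : ℂ_[p]) (f : C(ℤ_[p], ℂ_[p]))
    (s : ℤ_[p]) : ℂ_[p] :=
  ∑' n : ℕ, opL ι a n f s

/-! ## Ramification -/

/-- The value group `‖Kˣ‖` of an intermediate field of `ℂ_[p] / ℚ_[p]`. -/
def valueGroup (K : IntermediateField ℚ_[p] ℂ_[p]) : Subgroup ℝˣ :=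
  ((Units.map (normHom : ℂ_[p] →*₀ ℝ).toMonoidHom).comp
    (Units.map (algebraMap K ℂ_[p]).toMonoidHom)).range

/-- The ramification index `[‖Kˣ‖ : ‖ℚ_[p]ˣ‖]` of a finite extension `K` of `ℚ_[p]`. -/
def ramificationIndex (K : IntermediateField ℚ_[p] ℂ_[p]) : ℕ :=
  (valueGroup (⊥ : IntermediateField ℚ_[p] ℂ_[p])).relIndex (valueGroup K)

end PadicVanGorder

end

open PadicVanGorder

noncomputable section

namespace PadicVanGorder

variable {p : ℕ} [Fact p.Prime]

/-! ## Ultrametric estimates in `ℂ_[p]` -/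

/-! Translation by `t` agrees with the exponential series on polynomials by Taylor's formula, and
polynomials are dense, so `expD t` is translation (`expD_apply`). Since `1 < ‖a‖`, a shift by `t ∈
ℤ_[p]` changes neither valuation nor Teichmüller representative. Hence `x(t) = ⟨a + t⟩` is affine in
`t`, and `x(t - 1) = x(t) + z` with `z = -1/ω_v(a)`, `‖z‖ < 1`.

The binomial theorem expands `x(t - 1)^(1-s)` as `∑ (1-s choose n) z^n x(t)^(1-s-n)`, uniformly in
`t`. Applying the functional `∫ - (value at 0)` termwise produces `F(s + n)`. The relation `∫ f(t -
1) + ∫ f = 2 f(-1)` evaluates the left side as `x(-1)^(1-s) - x(0)^(1-s) - F(s)`. As `(s - 1) P_n`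
equals `(1-s choose n) z^n`, plus `1` at `n = 0`, the extra `1` cancels `-F(s)`; this is
`hasSum_opL_zetaSub`.

For the derivatives, write `x^(s + p^m v) = x^s (x^(p^m))^v`. Once `‖x^(p^m) - 1‖` is uniformly
below `p^(-1/(p-1))`, integration gives a Mahler series in `v` whose coefficients beat the growth of
`1/n!`, hence a power series (`exists_hasSum_pow_zetaSub`). Some `m` always works. With ramification
index below `p - 1`, `m = 0` works, because elements of `K` of norm below `1` already have norm
below `p^(-1/(p-1))`. This applies to `1/a`, and to `⟨a⟩ - 1` after passing to a power of `⟨a⟩` that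
lies in `K`. -/

theorem norm_eq_of_norm_sub_lt {x y : ℂ_[p]} (h : ‖x - y‖ < ‖y‖) : ‖x‖ = ‖y‖ := by
  have h1 : ‖x + -y‖ < max ‖x‖ ‖-y‖ := by
    rw [← sub_eq_add_neg, norm_neg]
    exact lt_max_of_lt_right h
  simpa using IsUltrametricDist.norm_eq_of_add_norm_lt_max h1

theorem norm_sub_le_max' (x y : ℂ_[p]) : ‖x - y‖ ≤ max ‖x‖ ‖y‖ := by
  simpa [sub_eq_add_neg] using IsUltrametricDist.norm_add_le_max x (-y)

theorem norm_natCast_prime : ‖(p : ℂ_[p])‖ = (p : ℝ)⁻¹ := by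
  rw [← map_natCast (algebraMap ℚ_[p] ℂ_[p]), norm_algebraMap', Padic.norm_p]

theorem norm_natCast_of_not_dvd {n : ℕ} (hn : ¬ p ∣ n) : ‖(n : ℂ_[p])‖ = 1 := by
  rw [← map_natCast (algebraMap ℚ_[p] ℂ_[p]), norm_algebraMap', Padic.norm_natCast_eq_one_iff]
  exact ((Nat.Prime.coprime_iff_not_dvd Fact.out).mpr hn)

theorem inv_prime_lt_one : (p : ℝ)⁻¹ < 1 :=
  inv_lt_one_of_one_lt₀ (by exact_mod_cast (Fact.out : p.Prime).one_lt)

theorem exists_one_add_pow_prime (y : ℂ_[p]) (hy : ‖y‖ ≤ 1) :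
    ∃ r : ℂ_[p], ‖r‖ ≤ 1 ∧ (1 + y) ^ p = 1 + y ^ p + p * y * r := by
  refine ⟨_, ?_, by simpa using add_pow_prime_eq (Fact.out : p.Prime) (1 : ℂ_[p]) y⟩
  refine IsUltrametricDist.norm_sum_le_of_forall_le_of_nonneg zero_le_one fun k _ => ?_
  rw [norm_mul, norm_pow]
  exact mul_le_one₀ (pow_le_one₀ (norm_nonneg _) hy) (norm_nonneg _)
    (IsUltrametricDist.norm_natCast_le_one _ _)

theorem norm_pow_prime_sub_one_le {x : ℂ_[p]} (hx : ‖x - 1‖ ≤ 1) :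
    ‖x ^ p - 1‖ ≤ ‖x - 1‖ * max ‖x - 1‖ (p : ℝ)⁻¹ := by
  obtain ⟨r, hr, h⟩ := exists_one_add_pow_prime (x - 1) hx
  have h2 : x ^ p - 1 = (x - 1) ^ p + p * (x - 1) * r := by
    rw [add_sub_cancel] at h
    rw [h]; ring
  rw [h2, mul_max_of_nonneg _ _ (norm_nonneg _)]
  refine (IsUltrametricDist.norm_add_le_max _ _).trans (max_le_max ?_ ?_)
  · rw [norm_pow, ← sq]
    exact pow_le_pow_of_le_one (norm_nonneg _) hx (Fact.out : p.Prime).two_le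
  · rw [norm_mul, norm_mul, norm_natCast_prime, mul_comm (p : ℝ)⁻¹]
    exact mul_le_of_le_one_right (by positivity) hr

/-- Frobenius is injective on the residue field: `(x - 1)^p` and `x^p - 1` agree modulo `p`. -/
theorem norm_sub_one_lt_of_pow_prime {x : ℂ_[p]} (hx : ‖x‖ ≤ 1) (h : ‖x ^ p - 1‖ < 1) :
    ‖x - 1‖ < 1 := by
  have hy : ‖x - 1‖ ≤ 1 := (norm_sub_le_max' _ _).trans (by simp [hx])
  obtain ⟨r, hr, h1⟩ := exists_one_add_pow_prime (x - 1) hy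
  have h2 : (x - 1) ^ p = (x ^ p - 1) - p * (x - 1) * r := by
    rw [add_sub_cancel] at h1
    rw [h1]; ring
  have h3 : ‖(x - 1) ^ p‖ < 1 := by
    rw [h2]
    refine (norm_sub_le_max' _ _).trans_lt (max_lt h ?_)
    rw [norm_mul, norm_mul, norm_natCast_prime]
    calc (p : ℝ)⁻¹ * ‖x - 1‖ * ‖r‖ ≤ (p : ℝ)⁻¹ * 1 * 1 := by gcongr
      _ < 1 := by simpa using inv_prime_lt_one
  rw [norm_pow] at h3
  exact (pow_lt_one_iff_of_nonneg (norm_nonneg _) (Fact.out : p.Prime).ne_zero).mp h3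

theorem norm_sub_one_lt_of_pow_prime_pow {x : ℂ_[p]} (hx : ‖x‖ ≤ 1) {k : ℕ}
    (h : ‖x ^ p ^ k - 1‖ < 1) : ‖x - 1‖ < 1 := by
  induction k with
  | zero => simpa using h
  | succ k ih =>
    refine ih (norm_sub_one_lt_of_pow_prime ?_ ?_)
    · rw [norm_pow]; exact pow_le_one₀ (norm_nonneg _) hx
    · rwa [← pow_mul, ← pow_succ]

/-- Raising to the power `p ^ m` contracts towards `1`. -/
theorem norm_pow_prime_pow_sub_one_le {x : ℂ_[p]} {ρ : ℝ} (hρ : ρ ≤ 1) (hpρ : (p : ℝ)⁻¹ ≤ ρ)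
    (hx : ‖x - 1‖ ≤ ρ) (m : ℕ) : ‖x ^ p ^ m - 1‖ ≤ ρ ^ (m + 1) := by
  have hρ0 : 0 ≤ ρ := (norm_nonneg _).trans hx
  induction m with
  | zero => simpa using hx
  | succ m ih =>
    have h1 : ‖x ^ p ^ m - 1‖ ≤ ρ := ih.trans (pow_le_of_le_one hρ0 hρ (by omega))
    rw [pow_succ p, pow_mul, pow_succ ρ]
    refine (norm_pow_prime_sub_one_le (h1.trans hρ)).trans ?_
    exact mul_le_mul ih (max_le h1 hpρ) (by positivity) (by positivity)

/-! ## Teichmüller representatives and valuations -/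

/-- The field `ℚ_[p](u)` is locally compact, so two powers of `u` come within distance less than `1`
of each other. The `p`-part of the difference of their exponents is then removed by injectivity of
Frobenius. -/
theorem exists_pow_sub_one_lt_of_isAlgebraic {u : ℂ_[p]} (hu : IsAlgebraic ℚ_[p] u)
    (h1 : ‖u‖ = 1) : ∃ m : ℕ, 0 < m ∧ ¬ p ∣ m ∧ ‖u ^ m - 1‖ < 1 := by
  let K := IntermediateField.adjoin ℚ_[p] {u}
  have : FiniteDimensional ℚ_[p] K := IntermediateField.adjoin.finiteDimensional hu.isIntegral
  have : ProperSpace K := FiniteDimensional.proper ℚ_[p] K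
  let w : K := ⟨u, IntermediateField.mem_adjoin_simple_self _ _⟩
  have hw : ‖w‖ = 1 := h1
  obtain ⟨b, -, φ, hφ, hlim⟩ := tendsto_subseq_of_bounded (Metric.isBounded_closedBall (x := 0)
    (r := 1)) (x := fun n => w ^ n) (fun n => by simp [hw])
  have hc := hlim.cauchySeq
  obtain ⟨N, hN⟩ := Metric.cauchySeq_iff.mp hc 1 one_pos
  have hlt := hφ (Nat.lt_succ_self N)
  obtain ⟨d, hd⟩ := Nat.exists_eq_add_of_lt hlt
  have h2 : ‖u ^ (d + 1) - 1‖ < 1 := by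
    have h3 := hN (N + 1) (Nat.le_succ N) N le_rfl
    rw [dist_eq_norm] at h3
    have h4 : ‖u ^ φ (N + 1) - u ^ φ N‖ < 1 := h3
    rw [hd, add_assoc, pow_add] at h4
    have h5 : u ^ φ N * u ^ (d + 1) - u ^ φ N = u ^ φ N * (u ^ (d + 1) - 1) := by ring
    rwa [h5, norm_mul, norm_pow, h1, one_pow, one_mul] at h4
  obtain ⟨k, m, hm, hdm⟩ := Nat.exists_eq_pow_mul_and_not_dvd (Nat.succ_ne_zero d) p
    (Fact.out : p.Prime).ne_one
  refine ⟨m, Nat.pos_of_ne_zero fun h => hm (h ▸ dvd_zero p), hm,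
    norm_sub_one_lt_of_pow_prime_pow (k := k) ?_ ?_⟩
  · rw [norm_pow, h1, one_pow]
  · rwa [← pow_mul, mul_comm m, ← hdm]

theorem exists_isAlgebraic_norm_sub_lt (a : ℂ_[p]) {ε : ℝ} (hε : 0 < ε) :
    ∃ b : ℂ_[p], IsAlgebraic ℚ_[p] b ∧ ‖a - b‖ < ε := by
  obtain ⟨y, hy⟩ := (UniformSpace.Completion.denseRange_coe (α := PadicAlgCl p)).exists_dist_lt a hε
  refine ⟨(y : ℂ_[p]), ?_, by rwa [← dist_eq_norm]⟩
  exact (Algebra.IsAlgebraic.isAlgebraic (R := ℚ_[p]) y).algebraMap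

/-- `u^m - 1` is the product of the `u - ζ` over the roots `ζ` of `X^m - 1`, so not every factor can
have norm at least `1`. -/
theorem exists_norm_sub_root_lt {u : ℂ_[p]} {m : ℕ} (hm : 0 < m) (h : ‖u ^ m - 1‖ < 1) :
    ∃ ζ : ℂ_[p], ζ ^ m = 1 ∧ ‖u - ζ‖ < 1 := by
  have hmon : (X ^ m - 1 : ℂ_[p][X]).Monic := monic_X_pow_sub_C 1 hm.ne'
  have hs := (IsAlgClosed.splits (X ^ m - 1 : ℂ_[p][X])).eq_prod_roots_of_monic hmon
  by_contra! hcon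
  have h1 := congrArg (eval u) hs
  rw [eval_multiset_prod, Multiset.map_map] at h1
  simp only [eval_sub, eval_pow, eval_X, eval_one, Function.comp_def, eval_C] at h1
  have h2 : ∀ s : Multiset ℂ_[p], (∀ z ∈ s, z ^ m = 1) → 1 ≤ ‖(s.map fun z => u - z).prod‖ := by
    intro s
    induction s using Multiset.induction_on with
    | empty => simp
    | cons z s ih =>
      intro hz
      rw [Multiset.map_cons, Multiset.prod_cons, norm_mul]
      exact one_le_mul_of_one_le_of_one_le (hcon z (hz z (Multiset.mem_cons_self z s)))
        (ih fun y hy => hz y (Multiset.mem_cons_of_mem hy))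
  have h3 := h2 (X ^ m - 1 : ℂ_[p][X]).roots fun z hz => by
    have := (mem_roots'.mp hz).2
    simpa [sub_eq_zero] using this
  rw [← h1] at h3
  exact absurd h (not_lt.mpr h3)

theorem exists_teich {u : ℂ_[p]} (hu : ‖u‖ = 1) :
    ∃ ζ : ℂ_[p], IsPrimeToPRootOfUnity ζ ∧ ‖u - ζ‖ < 1 := by
  obtain ⟨b, hb, hub⟩ := exists_isAlgebraic_norm_sub_lt u one_pos
  have hb1 : ‖b‖ = 1 := by
    rw [← hu]
    exact norm_eq_of_norm_sub_lt (by rwa [norm_sub_rev, hu])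
  obtain ⟨m, hm, hpm, h⟩ := exists_pow_sub_one_lt_of_isAlgebraic hb hb1
  obtain ⟨ζ, hζ, hbζ⟩ := exists_norm_sub_root_lt hm h
  refine ⟨ζ, ⟨m, hm, hpm, hζ⟩, ?_⟩
  rw [← sub_add_sub_cancel u b ζ]
  exact (IsUltrametricDist.norm_add_le_max _ _).trans_lt (max_lt hub hbζ)

/-- The norm of `K` is the spectral norm, so conjugates have equal norm, and the constant
coefficient is up to sign their product. -/
theorem norm_pow_natDegree_minpoly {K : Type*} [NormedField K] [NormedAlgebra ℚ_[p] K]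
    [Algebra.IsAlgebraic ℚ_[p] K] (x : K) :
    ‖x‖ ^ (minpoly ℚ_[p] x).natDegree = ‖(minpoly ℚ_[p] x).coeff 0‖ := by
  have h := (minpoly.natDegree_pos (Algebra.IsIntegral.isIntegral (R := ℚ_[p]) x)).ne'
  rw [NormedAlgebra.norm_eq_spectralNorm ℚ_[p],
    spectralNorm.spectralNorm_eq_norm_coeff_zero_rpow, one_div,
    Real.rpow_inv_natCast_pow (norm_nonneg _) h]

theorem exists_norm_eq_rpow {a : ℂ_[p]} (ha : a ≠ 0) :
    ∃ r : ℚ, ‖a‖ = (p : ℝ) ^ (-(r : ℝ)) := by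
  obtain ⟨y, hy⟩ := (UniformSpace.Completion.denseRange_coe (α := PadicAlgCl p)).exists_dist_lt a
    (norm_pos_iff.mpr ha)
  have hya : ‖a‖ = ‖y‖ := by
    rw [← UniformSpace.Completion.norm_coe y]
    exact (norm_eq_of_norm_sub_lt (by rwa [← dist_eq_norm, dist_comm])).symm
  have hy0 : y ≠ 0 := fun h => ha (norm_eq_zero.mp (by rw [hya, h, norm_zero]))
  have hint := Algebra.IsIntegral.isIntegral (R := ℚ_[p]) y
  have h := norm_pow_natDegree_minpoly (p := p) y
  have hd := (minpoly.natDegree_pos hint).ne'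
  set d := (minpoly ℚ_[p] y).natDegree
  have hp0 : (0 : ℝ) ≤ p := Nat.cast_nonneg p
  rw [Padic.norm_eq_zpow_neg_valuation (minpoly.coeff_zero_ne_zero hint hy0)] at h
  set v := ((minpoly ℚ_[p] y).coeff 0).valuation
  refine ⟨v / d, ?_⟩
  rw [hya, ← pow_left_inj₀ (norm_nonneg _) (Real.rpow_nonneg hp0 _) hd, h, ← Real.rpow_natCast,
    ← Real.rpow_mul hp0, ← Real.rpow_intCast]
  congr 1
  push_cast
  field_simp

theorem norm_eq_rpow_vp {a : ℂ_[p]} (ha : a ≠ 0) : ‖a‖ = (p : ℝ) ^ (-(vp a : ℝ)) := by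
  have h := exists_norm_eq_rpow ha
  rw [vp, dif_pos h]
  exact h.choose_spec

theorem ratPow_pow_den (ι : algebraicClosure ℚ ℂ →+* ℂ_[p]) (r : ℚ) :
    ratPow ι r ^ r.den = (p : ℂ_[p]) ^ r.num := by
  have hp0 : (0 : ℝ) ≤ (p : ℝ) := Nat.cast_nonneg p
  rw [ratPow, ← map_pow, ← map_natCast ι p, ← map_zpow₀]
  congr 1
  apply Subtype.ext
  push_cast
  rw [← Complex.ofReal_pow, ← Real.rpow_natCast, ← Real.rpow_mul hp0]
  have h : (r : ℝ) * (r.den : ℝ) = ((r.num : ℤ) : ℝ) := by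
    exact_mod_cast Rat.mul_den_eq_num r
  rw [h, Real.rpow_intCast]
  push_cast
  rfl

theorem norm_ratPow (ι : algebraicClosure ℚ ℂ →+* ℂ_[p]) (r : ℚ) :
    ‖ratPow ι r‖ = (p : ℝ) ^ (-(r : ℝ)) := by
  have hp0 : (0 : ℝ) ≤ (p : ℝ) := Nat.cast_nonneg p
  rw [← pow_left_inj₀ (norm_nonneg _) (Real.rpow_nonneg hp0 _) r.den_ne_zero, ← norm_pow,
    ratPow_pow_den, norm_zpow, norm_natCast_prime, ← Real.rpow_natCast, ← Real.rpow_mul hp0]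
  have h : -(r : ℝ) * (r.den : ℝ) = ((-r.num : ℤ) : ℝ) := by
    have : (r : ℝ) * (r.den : ℝ) = ((r.num : ℤ) : ℝ) := by
      exact_mod_cast Rat.mul_den_eq_num r
    push_cast
    rw [neg_mul, this]
  rw [h, Real.rpow_intCast, inv_zpow, zpow_neg]

theorem ratPow_add (ι : algebraicClosure ℚ ℂ →+* ℂ_[p]) (r t : ℚ) :
    ratPow ι (r + t) = ratPow ι r * ratPow ι t := by
  have hp0 : (0 : ℝ) < (p : ℝ) := Nat.cast_pos.mpr (Fact.out : p.Prime).pos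
  rw [ratPow, ratPow, ratPow, ← map_mul]
  congr 1
  apply Subtype.ext
  push_cast
  rw [← Complex.ofReal_mul, ← Real.rpow_add hp0]

theorem ratPow_zero (ι : algebraicClosure ℚ ℂ →+* ℂ_[p]) : ratPow ι 0 = 1 := by
  rw [ratPow, ← map_one ι]
  congr 1
  apply Subtype.ext
  simp

theorem ratPow_neg_mul (ι : algebraicClosure ℚ ℂ →+* ℂ_[p]) (r : ℚ) :
    ratPow ι (-r) * ratPow ι r = 1 := by
  rw [← ratPow_add, neg_add_cancel, ratPow_zero]

theorem norm_eq_one_of_isPrimeToPRootOfUnity {ζ : ℂ_[p]} (h : IsPrimeToPRootOfUnity ζ) :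
    ‖ζ‖ = 1 := by
  obtain ⟨m, hm, -, h⟩ := h
  have h1 := congrArg norm h
  rw [norm_pow, norm_one] at h1
  exact (pow_eq_one_iff_of_nonneg (norm_nonneg _) hm.ne').mp h1

section projections

variable (ι : algebraicClosure ℚ ℂ →+* ℂ_[p]) {a : ℂ_[p]}

theorem norm_ratPow_vp (ha : a ≠ 0) : ‖ratPow ι (vp a)‖ = ‖a‖ := by
  rw [norm_ratPow, norm_eq_rpow_vp ha]

theorem teich_spec (ha : a ≠ 0) :
    IsPrimeToPRootOfUnity (teich ι a) ∧ ‖a / ratPow ι (vp a) - teich ι a‖ < 1 := by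
  have h := exists_teich (u := a / ratPow ι (vp a))
    (by rw [norm_div, norm_ratPow_vp ι ha, div_self (norm_ne_zero_iff.mpr ha)])
  rw [teich, teichUnit, dif_pos h]
  exact h.choose_spec

theorem norm_teich (ha : a ≠ 0) : ‖teich ι a‖ = 1 :=
  norm_eq_one_of_isPrimeToPRootOfUnity (teich_spec ι ha).1

theorem norm_omegaV (ha : a ≠ 0) : ‖omegaV ι a‖ = ‖a‖ := by
  rw [omegaV, norm_mul, norm_ratPow_vp ι ha, norm_teich ι ha, mul_one]

theorem angle_eq_div (a : ℂ_[p]) : angle ι a = a / omegaV ι a := by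
  rw [angle, omegaV, eq_inv_of_mul_eq_one_left (ratPow_neg_mul ι (vp a)), div_mul_eq_div_div,
    div_eq_inv_mul a]

theorem norm_angle_sub_one_lt (ha : a ≠ 0) : ‖angle ι a - 1‖ < 1 := by
  have h := (teich_spec ι ha).2
  have h0 : teich ι a ≠ 0 := norm_ne_zero_iff.mp (by rw [norm_teich ι ha]; exact one_ne_zero)
  have h1 : angle ι a - 1 = (a / ratPow ι (vp a) - teich ι a) / teich ι a := by
    rw [angle_eq_div, omegaV, sub_div, div_self h0, div_mul_eq_div_div]
  rwa [h1, norm_div, norm_teich ι ha, div_one]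

open Classical in
-- Equivalent predicates yield the same chosen element. This makes `vp` and `teichUnit` invariant
-- under small shifts without any appeal to uniqueness of the valuation or of the root of unity.
theorem dite_choose_congr {α : Type*} {P Q : α → Prop} (h : ∀ x, P x ↔ Q x) (d : α) :
    (if h : ∃ x, P x then h.choose else d) = if h : ∃ x, Q x then h.choose else d := by
  obtain rfl : P = Q := funext fun x => propext (h x)
  rfl

theorem vp_congr {b : ℂ_[p]} (h : ‖a‖ = ‖b‖) : vp a = vp b := by
  rw [vp, vp]
  exact dite_choose_congr (fun r => by rw [h]) 0

theorem omegaV_add {t : ℂ_[p]} (ha : 1 < ‖a‖) (ht : ‖t‖ ≤ 1) :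
    omegaV ι (a + t) = omegaV ι a := by
  have ha0 : a ≠ 0 := norm_pos_iff.mp (one_pos.trans ha)
  have hv : vp (a + t) = vp a :=
    vp_congr (norm_eq_of_norm_sub_lt (by simpa using ht.trans_lt ha))
  have hlt : ‖t / ratPow ι (vp a)‖ < 1 := by
    rw [norm_div, norm_ratPow_vp ι ha0, div_lt_one (one_pos.trans ha)]
    exact ht.trans_lt ha
  have hpred : ∀ ζ : ℂ_[p], ‖(a + t) / ratPow ι (vp a) - ζ‖ < 1 ↔ ‖a / ratPow ι (vp a) - ζ‖ < 1 := by
    intro ζ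
    constructor <;> intro h
    · have : a / ratPow ι (vp a) - ζ = (a + t) / ratPow ι (vp a) - ζ - t / ratPow ι (vp a) := by
        ring
      rw [this]
      exact (norm_sub_le_max' _ _).trans_lt (max_lt h hlt)
    · have : (a + t) / ratPow ι (vp a) - ζ = a / ratPow ι (vp a) - ζ + t / ratPow ι (vp a) := by
        ring
      rw [this]
      exact (IsUltrametricDist.norm_add_le_max _ _).trans_lt (max_lt h hlt)
  rw [omegaV, omegaV, teich, teich, hv, teichUnit, teichUnit]
  exact congrArg _ (dite_choose_congr (fun ζ => and_congr_right fun _ => hpred ζ) 1)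

theorem angle_add {t : ℂ_[p]} (ha : 1 < ‖a‖) (ht : ‖t‖ ≤ 1) :
    angle ι (a + t) = angle ι a + t / omegaV ι a := by
  rw [angle_eq_div, angle_eq_div, omegaV_add ι ha ht, add_div]

end projections

theorem norm_toC (t : ℤ_[p]) : ‖(toC t : ℂ_[p])‖ = ‖t‖ := by
  rw [toC, norm_algebraMap']; rfl

theorem norm_toC_le_one (t : ℤ_[p]) : ‖(toC t : ℂ_[p])‖ ≤ 1 := by
  rw [norm_toC]; exact PadicInt.norm_le_one t

/-- `toC` as a ring homomorphism. -/
def toCHom : ℤ_[p] →+* ℂ_[p] := (algebraMap ℚ_[p] ℂ_[p]).comp PadicInt.Coe.ringHom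

theorem toC_zero : (toC 0 : ℂ_[p]) = 0 := map_zero toCHom
theorem toC_one : (toC 1 : ℂ_[p]) = 1 := map_one toCHom
theorem toC_natCast (n : ℕ) : (toC n : ℂ_[p]) = n := map_natCast toCHom n
theorem toC_neg (s : ℤ_[p]) : (toC (-s) : ℂ_[p]) = -toC s := map_neg toCHom s
theorem toC_sub (s t : ℤ_[p]) : (toC (s - t) : ℂ_[p]) = toC s - toC t := map_sub toCHom s t
theorem toC_mul (s t : ℤ_[p]) : (toC (s * t) : ℂ_[p]) = toC s * toC t := map_mul toCHom s t
theorem toC_pow (s : ℤ_[p]) (n : ℕ) : (toC (s ^ n) : ℂ_[p]) = toC s ^ n := map_pow toCHom s n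

theorem toC_injective : Function.Injective (toC : ℤ_[p] → ℂ_[p]) :=
  (algebraMap ℚ_[p] ℂ_[p]).injective.comp Subtype.val_injective

/-! ## The binomial series -/

/-- The binomial coefficient `s.choose n` as an element of `ℂ_[p]`. -/
def chooseC (s : ℤ_[p]) (n : ℕ) : ℂ_[p] := toC (Ring.choose s n)

theorem norm_chooseC_le (s : ℤ_[p]) (n : ℕ) : ‖(chooseC s n : ℂ_[p])‖ ≤ 1 := norm_toC_le_one _

theorem continuous_chooseC (n : ℕ) : Continuous fun s : ℤ_[p] => (chooseC s n : ℂ_[p]) :=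
  continuous_toC.comp (PadicInt.continuous_choose n)

theorem chooseC_natCast (N n : ℕ) : (chooseC (N : ℤ_[p]) n : ℂ_[p]) = N.choose n := by
  rw [chooseC, Ring.choose_natCast, toC_natCast]

/-- Reconciles the integral coefficient, of norm at most `1`, with the quotient in `anglePow`; both
sides are continuous and agree on the dense set `ℕ`. -/
theorem chooseC_eq_prod (s : ℤ_[p]) (n : ℕ) :
    (chooseC s n : ℂ_[p]) = (∏ i ∈ Finset.range n, (toC s - i)) / (n.factorial : ℂ_[p]) := by
  have hn : ((n.factorial : ℕ) : ℂ_[p]) ≠ 0 := Nat.cast_ne_zero.mpr n.factorial_ne_zero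
  rw [eq_div_iff hn]
  refine congrFun (PadicInt.denseRange_natCast.equalizer
    (g := fun s : ℤ_[p] => (chooseC s n : ℂ_[p]) * (n.factorial : ℂ_[p]))
    (h := fun s => ∏ i ∈ Finset.range n, (toC s - (i : ℂ_[p])))
    ((continuous_chooseC n).mul continuous_const) ?_ (funext fun N => ?_)) s
  · exact continuous_finsetProd _ fun i _ => continuous_toC.sub continuous_const
  · simp only [Function.comp_apply, chooseC_natCast, toC_natCast]
    rw [← Nat.cast_mul, mul_comm, ← Nat.descFactorial_eq_factorial_mul_choose,
      ← descPochhammer_eval_eq_descFactorial, descPochhammer_eval_eq_prod_range]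

/-- `x ^ s` for `s ∈ ℤ_[p]` and `‖x - 1‖ < 1`, as a binomial series. -/
def binomPow (x : ℂ_[p]) (s : ℤ_[p]) : ℂ_[p] := ∑' n : ℕ, chooseC s n * (x - 1) ^ n

theorem anglePow_toC (ι : algebraicClosure ℚ ℂ →+* ℂ_[p]) (a : ℂ_[p]) (s : ℤ_[p]) :
    anglePow ι a (toC s) = binomPow (angle ι a) s := by
  simp only [anglePow, binomPow, chooseC_eq_prod]

theorem norm_chooseC_mul_pow_le {x : ℂ_[p]} {ρ : ℝ} (hx : ‖x‖ ≤ ρ) (s : ℤ_[p]) (n : ℕ) :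
    ‖chooseC s n * x ^ n‖ ≤ ρ ^ n := by
  rw [norm_mul, norm_pow]
  exact (mul_le_of_le_one_left (by positivity) (norm_chooseC_le s n)).trans (by gcongr)

theorem continuous_binomPow {Y : Type*} [TopologicalSpace Y] {f : Y → ℂ_[p]} {g : Y → ℤ_[p]}
    (hf : Continuous f) (hg : Continuous g) {ρ : ℝ} (hρ : ρ < 1) (hfρ : ∀ y, ‖f y - 1‖ ≤ ρ) :
    Continuous fun y => binomPow (f y) (g y) := by
  rcases isEmpty_or_nonempty Y with hY | ⟨⟨y₀⟩⟩
  · exact continuous_of_const fun y => (hY.false y).elim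
  refine continuous_tsum (fun n => ((continuous_chooseC n).comp hg).mul
    ((hf.sub continuous_const).pow n))
    (summable_geometric_of_lt_one ((norm_nonneg _).trans (hfρ y₀)) hρ)
    fun n y => norm_chooseC_mul_pow_le (hfρ y) _ n

theorem binomPow_natCast (x : ℂ_[p]) (N : ℕ) : binomPow x (N : ℤ_[p]) = x ^ N := by
  rw [binomPow, tsum_eq_sum (s := Finset.range (N + 1))]
  · conv_rhs => rw [← sub_add_cancel x 1, add_pow]
    refine Finset.sum_congr rfl fun n _ => ?_
    rw [chooseC_natCast, one_pow, mul_one, mul_comm]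
  · intro n hn
    rw [chooseC_natCast, Nat.choose_eq_zero_of_lt (by simpa using hn), Nat.cast_zero, zero_mul]

theorem norm_binomPow_le {x : ℂ_[p]} (hx : ‖x - 1‖ < 1) (s : ℤ_[p]) : ‖binomPow x s‖ ≤ 1 := by
  refine IsUltrametricDist.norm_tsum_le_of_forall_le fun n => ?_
  refine (norm_chooseC_mul_pow_le le_rfl s n).trans (pow_le_one₀ (norm_nonneg _) hx.le)

theorem binomPow_add_mul_pow {x : ℂ_[p]} (hx : ‖x - 1‖ < 1) (m : ℕ)
    (hxm : ‖x ^ p ^ m - 1‖ < 1) (s v : ℤ_[p]) :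
    binomPow x (s + p ^ m * v) = binomPow x s * binomPow (x ^ p ^ m) v := by
  have hd : DenseRange (Prod.map (Nat.cast : ℕ → ℤ_[p]) (Nat.cast : ℕ → ℤ_[p])) :=
    PadicInt.denseRange_natCast.prodMap PadicInt.denseRange_natCast
  refine congrFun (hd.equalizer (g := fun q => binomPow x (q.1 + p ^ m * q.2))
    (h := fun q => binomPow x q.1 * binomPow (x ^ p ^ m) q.2) ?_ ?_ (funext fun N => ?_)) (s, v)
  · exact continuous_binomPow continuous_const (by fun_prop) hx fun _ => le_rfl
  · exact (continuous_binomPow continuous_const (by fun_prop) hx fun _ => le_rfl).mul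
      (continuous_binomPow continuous_const (by fun_prop) hxm fun _ => le_rfl)
  · simp only [Function.comp_apply, Prod.map_fst, Prod.map_snd]
    rw [← Nat.cast_pow, ← Nat.cast_mul, ← Nat.cast_add]
    simp only [binomPow_natCast]
    rw [pow_add, pow_mul]

/-- The binomial theorem for `(x + z) ^ s`. -/
theorem tsum_chooseC_mul_pow_mul_binomPow {x z : ℂ_[p]} (hx : ‖x - 1‖ < 1) (hz : ‖z‖ < 1)
    (s : ℤ_[p]) :
    ∑' n : ℕ, chooseC s n * z ^ n * binomPow x (s - n) = binomPow (x + z) s := by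
  have hxz : ‖x + z - 1‖ < 1 := by
    rw [add_sub_right_comm]
    exact (IsUltrametricDist.norm_add_le_max _ _).trans_lt (max_lt hx hz)
  -- Both sides are continuous in `s`. At `s = N` the coefficient vanishes for `n > N`, exactly
  -- where `N - n` would be negative, and the finite binomial theorem remains.
  refine congrFun (PadicInt.denseRange_natCast.equalizer
    (g := fun s : ℤ_[p] => ∑' n : ℕ, chooseC s n * z ^ n * binomPow x (s - n))
    (h := fun s => binomPow (x + z) s) ?_ ?_ (funext fun N => ?_)) s
  · refine continuous_tsum (fun n => ?_) (summable_geometric_of_lt_one (norm_nonneg z) hz)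
      fun n s => ?_
    · exact ((continuous_chooseC n).mul continuous_const).mul
        (continuous_binomPow continuous_const (by fun_prop) hx fun _ => le_rfl)
    · rw [norm_mul]
      exact (mul_le_of_le_one_right (norm_nonneg _) (norm_binomPow_le hx _)).trans
        (norm_chooseC_mul_pow_le le_rfl s n)
  · exact continuous_binomPow continuous_const continuous_id hxz fun _ => le_rfl
  · simp only [Function.comp_apply]
    rw [binomPow_natCast, tsum_eq_sum (s := Finset.range (N + 1)), add_comm x z, add_pow]
    · refine Finset.sum_congr rfl fun n hn => ?_
      rw [← Nat.cast_sub (Nat.lt_succ_iff.mp (Finset.mem_range.mp hn)), binomPow_natCast,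
        chooseC_natCast]
      ring
    · intro n hn
      rw [chooseC_natCast, Nat.choose_eq_zero_of_lt (by simpa using hn), Nat.cast_zero, zero_mul,
        zero_mul]

/-! ## The fermionic integral of a continuous function -/

theorem sum_range_mul_eq {M : Type*} [AddCommMonoid M] (g : ℕ → M) (N q : ℕ) :
    ∑ j ∈ Finset.range (N * q), g j =
      ∑ i ∈ Finset.range q, ∑ k ∈ Finset.range N, g (N * i + k) := by
  induction q with
  | zero => simp
  | succ q ih => rw [Nat.mul_succ, Finset.sum_range_add, ih, Finset.sum_range_succ]

/-- For odd `p` the signs `(-1)^i`, `i < p`, add up to `1`, so the sum of level `r` can be spread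
over the `p` blocks of level `r + 1` with matching signs. -/
theorem fermionicSum_succ_sub (hp : p ≠ 2) (f : ℤ_[p] → ℂ_[p]) (r : ℕ) :
    fermionicSum f (r + 1) - fermionicSum f r =
      ∑ i ∈ Finset.range p, ∑ k ∈ Finset.range (p ^ r),
        (f (k + p ^ r * i) - f k) * (-1) ^ (k + i) := by
  have hodd : Odd p := (Fact.out : p.Prime).odd_of_ne_two hp
  have h1 : fermionicSum f r =
      ∑ i ∈ Finset.range p, ∑ k ∈ Finset.range (p ^ r), f k * (-1) ^ (k + i) := by
    simp only [pow_add, ← mul_assoc, ← Finset.sum_mul, ← Finset.mul_sum]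
    rw [neg_one_geom_sum, if_neg (Nat.not_even_iff_odd.mpr hodd), mul_one, fermionicSum]
  rw [h1, fermionicSum, pow_succ, sum_range_mul_eq, ← Finset.sum_sub_distrib]
  refine Finset.sum_congr rfl fun i _ => ?_
  rw [← Finset.sum_sub_distrib]
  refine Finset.sum_congr rfl fun k _ => ?_
  have h2 : (-1 : ℂ_[p]) ^ (p ^ r * i + k) = (-1) ^ (k + i) := by
    rw [pow_add, pow_mul, (hodd.pow).neg_one_pow, add_comm, pow_add]
  rw [h2, sub_mul]
  push_cast
  rw [add_comm (_ * _) (k : ℤ_[p])]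

theorem norm_fermionicSum_le {f : ℤ_[p] → ℂ_[p]} {M : ℝ} (hM : 0 ≤ M) (hf : ∀ t, ‖f t‖ ≤ M)
    (r : ℕ) : ‖fermionicSum f r‖ ≤ M := by
  refine IsUltrametricDist.norm_sum_le_of_forall_le_of_nonneg hM fun k _ => ?_
  rw [norm_mul, norm_pow, norm_neg, norm_one, one_pow, mul_one]
  exact hf _

/-- Every continuous function has a fermionic integral. -/
theorem hasFermionicIntegral (hp : p ≠ 2) (f : C(ℤ_[p], ℂ_[p])) :
    HasFermionicIntegral f (fermionicIntegral f) := by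
  have hc : CauchySeq (fermionicSum f) := by
    -- In an ultrametric group it suffices that consecutive differences tend to `0`, which follows
    -- from uniform continuity of `f`.
    refine NonarchimedeanAddGroup.cauchySeq_of_tendsto_sub_nhds_zero ?_
    rw [Metric.tendsto_atTop]
    intro ε hε
    obtain ⟨δ, hδ, hfδ⟩ := Metric.uniformContinuous_iff.mp
      (CompactSpace.uniformContinuous_of_continuous f.continuous) (ε / 2) (half_pos hε)
    obtain ⟨N, hN⟩ := exists_pow_lt_of_lt_one hδ (inv_prime_lt_one (p := p))
    refine ⟨N, fun r hr => ?_⟩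
    rw [dist_zero_right, fermionicSum_succ_sub hp]
    refine (IsUltrametricDist.norm_sum_le_of_forall_le_of_nonneg (half_pos hε).le fun i _ =>
      IsUltrametricDist.norm_sum_le_of_forall_le_of_nonneg (half_pos hε).le fun k _ => ?_).trans_lt
        (half_lt_self hε)
    rw [norm_mul, norm_pow, norm_neg, norm_one, one_pow, mul_one, ← dist_eq_norm]
    refine (hfδ ?_).le
    rw [dist_eq_norm, add_sub_cancel_left, norm_mul, norm_pow, PadicInt.norm_p]
    calc (p : ℝ)⁻¹ ^ r * ‖(i : ℤ_[p])‖ ≤ (p : ℝ)⁻¹ ^ r * 1 := by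
          gcongr; exact PadicInt.norm_le_one _
      _ ≤ (p : ℝ)⁻¹ ^ N := by
          rw [mul_one]
          exact pow_le_pow_of_le_one (by positivity) inv_prime_lt_one.le hr
      _ < δ := hN
  exact hc.tendsto_limUnder

/-- The fermionic integral as a linear form. -/
def fermionicLinear (hp : p ≠ 2) : C(ℤ_[p], ℂ_[p]) →ₗ[ℂ_[p]] ℂ_[p] where
  toFun f := fermionicIntegral f
  map_add' f g := by
    refine tendsto_nhds_unique (hasFermionicIntegral hp (f + g)) ?_
    refine ((hasFermionicIntegral hp f).add (hasFermionicIntegral hp g)).congr fun r => ?_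
    simp only [fermionicSum, ContinuousMap.add_apply, add_mul, Finset.sum_add_distrib]
  map_smul' c f := by
    refine tendsto_nhds_unique (hasFermionicIntegral hp (c • f)) ?_
    refine ((hasFermionicIntegral hp f).const_mul c).congr fun r => ?_
    simp only [fermionicSum, ContinuousMap.smul_apply, smul_eq_mul, Finset.mul_sum, mul_assoc]

/-- The fermionic integral as a continuous linear form of norm at most `1`. -/
def fermionicCLM (hp : p ≠ 2) : C(ℤ_[p], ℂ_[p]) →L[ℂ_[p]] ℂ_[p] :=
  (fermionicLinear hp).mkContinuous 1 fun f => by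
    rw [one_mul]
    exact le_of_tendsto (hasFermionicIntegral hp f).norm
      (Eventually.of_forall fun r => norm_fermionicSum_le (norm_nonneg f) f.norm_coe_le_norm r)

theorem fermionicCLM_apply (hp : p ≠ 2) (f : C(ℤ_[p], ℂ_[p])) :
    fermionicCLM hp f = fermionicIntegral f := rfl

theorem norm_fermionicCLM_apply_le (hp : p ≠ 2) (f : C(ℤ_[p], ℂ_[p])) :
    ‖fermionicCLM hp f‖ ≤ ‖f‖ := by
  simpa using (fermionicCLM hp).le_of_opNorm_le
    (LinearMap.mkContinuous_norm_le _ zero_le_one _) f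

theorem tendsto_natCast_prime_pow : Tendsto (fun r : ℕ => ((p ^ r : ℕ) : ℤ_[p])) atTop (𝓝 0) := by
  push_cast
  exact tendsto_pow_atTop_nhds_zero_of_norm_lt_one (by rw [PadicInt.norm_p]; exact inv_prime_lt_one)

/-- Shifting the index reverses the sign, so the sum telescopes; the last term enters with a plus
because `p^r` is odd. As `r` grows, it too tends to `f(-1)`. -/
theorem fermionicSum_add_fermionicSum_shift (hp : p ≠ 2) (f : ℤ_[p] → ℂ_[p]) (r : ℕ) :
    fermionicSum (fun t => f (t - 1)) r + fermionicSum f r =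
      f (-1) + f ((p ^ r : ℕ) - 1) := by
  have hodd : Odd (p ^ r) := ((Fact.out : p.Prime).odd_of_ne_two hp).pow
  have key : ∀ N : ℕ, ∑ k ∈ Finset.range N, f (k - 1) * (-1) ^ k +
      ∑ k ∈ Finset.range N, f k * (-1) ^ k = f (-1) - (-1) ^ N * f (N - 1) := by
    intro N
    induction N with
    | zero => simp
    | succ N ih =>
      rw [Finset.sum_range_succ, Finset.sum_range_succ, add_add_add_comm, ih]
      push_cast
      rw [add_sub_cancel_right]
      ring
  rw [fermionicSum, fermionicSum, key, hodd.neg_one_pow]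
  ring

theorem fermionicCLM_add_fermionicCLM_shift (hp : p ≠ 2) {f g : C(ℤ_[p], ℂ_[p])}
    (hg : ∀ t, g t = f (t - 1)) : fermionicCLM hp g + fermionicCLM hp f = 2 * f (-1) := by
  refine tendsto_nhds_unique ((hasFermionicIntegral hp g).add (hasFermionicIntegral hp f)) ?_
  have h1 : Tendsto (fun r : ℕ => f (-1) + f ((p ^ r : ℕ) - 1)) atTop (𝓝 (f (-1) + f (0 - 1))) :=
    ((f.continuous.tendsto _).comp (tendsto_natCast_prime_pow.sub_const 1)).const_add _
  rw [zero_sub, ← two_mul] at h1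
  refine h1.congr fun r => ?_
  rw [← fermionicSum_add_fermionicSum_shift hp]
  congr 2
  exact funext fun t => (hg t).symm

/-! ## The operator `expD` is translation -/

theorem expD_apply (t : ℤ_[p]) (f : C(ℤ_[p], ℂ_[p])) (s : ℤ_[p]) : expD t f s = f (s + t) := by
  have h : IsExpD t (expD t) := (existsUnique_isExpD t).choose_spec.1
  let S : C(ℤ_[p], ℂ_[p]) →L[ℂ_[p]] C(ℤ_[p], ℂ_[p]) :=
    ⟨(ContinuousMap.compRightAlgHom ℂ_[p] ℂ_[p]
      (⟨fun s => s + t, by fun_prop⟩ : C(ℤ_[p], ℤ_[p]))).toLinearMap,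
      ContinuousMap.continuous_precomp _⟩
  have hS : IsExpD t S := fun q => by
    ext s
    change q.eval (toC (s + t)) = (expDPoly t q).eval (toC s)
    rw [expDPoly_eval, toC_add]
  rw [(existsUnique_isExpD t).unique h hS]
  rfl

/-! ## Integrals of binomial powers -/

/-- The function `t ↦ x(t) ^ s`. -/
def binomMap (x : C(ℤ_[p], ℂ_[p])) {ρ : ℝ} (hρ : ρ < 1) (hx : ∀ t, ‖x t - 1‖ ≤ ρ) (s : ℤ_[p]) :
    C(ℤ_[p], ℂ_[p]) :=
  ⟨fun t => binomPow (x t) s, continuous_binomPow x.continuous continuous_const hρ hx⟩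

section binomMap

variable (x : C(ℤ_[p], ℂ_[p])) {ρ : ℝ} (hρ : ρ < 1) (hx : ∀ t, ‖x t - 1‖ ≤ ρ)

theorem norm_binomMap_le (s : ℤ_[p]) : ‖binomMap x hρ hx s‖ ≤ 1 :=
  (ContinuousMap.norm_le _ zero_le_one).mpr fun t => norm_binomPow_le ((hx t).trans_lt hρ) s

theorem continuous_binomMap : Continuous (binomMap x hρ hx) := by
  let G : C(ℤ_[p] × ℤ_[p], ℂ_[p]) :=
    ⟨fun q => binomPow (x q.2) q.1, continuous_binomPow (x.continuous.comp continuous_snd)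
      continuous_fst hρ fun q => hx q.2⟩
  exact G.curry.continuous

/-- The function `s ↦ ∫ x(t) ^ (1 - s) dμ(t) - x(0) ^ (1 - s)`. -/
def zetaSub (hp : p ≠ 2) : C(ℤ_[p], ℂ_[p]) :=
  ⟨fun s => fermionicCLM hp (binomMap x hρ hx (1 - s)) - binomMap x hρ hx (1 - s) 0, by
    have h : Continuous fun s : ℤ_[p] => binomMap x hρ hx (1 - s) :=
      (continuous_binomMap x hρ hx).comp (by fun_prop)
    exact ((fermionicCLM hp).continuous.comp h).sub
      ((continuous_eval_const (0 : ℤ_[p])).comp h)⟩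

theorem zetaSub_apply (hp : p ≠ 2) (s : ℤ_[p]) : zetaSub x hρ hx hp s =
    fermionicCLM hp (binomMap x hρ hx (1 - s)) - binomPow (x 0) (1 - s) := rfl

/-- The binomial theorem as an identity in `C(ℤ_[p], ℂ_[p])`: convergence in the supremum norm
allows continuous linear forms to be applied termwise. -/
theorem hasSum_binomMap {z : ℂ_[p]} (hz : ‖z‖ < 1) (hxz : ∀ t, x t + z = x (t - 1)) (s : ℤ_[p])
    {g : C(ℤ_[p], ℂ_[p])} (hg : ∀ t, g t = binomMap x hρ hx s (t - 1)) :
    HasSum (fun n : ℕ => (chooseC s n * z ^ n) • binomMap x hρ hx (s - n)) g := by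
  have hs : Summable (fun n : ℕ => (chooseC s n * z ^ n) • binomMap x hρ hx (s - n)) := by
    refine Summable.of_norm_bounded (summable_geometric_of_lt_one (norm_nonneg z) hz) fun n => ?_
    rw [norm_smul]
    exact (mul_le_of_le_one_right (norm_nonneg _) (norm_binomMap_le x hρ hx _)).trans
      (norm_chooseC_mul_pow_le le_rfl s n)
  obtain ⟨g', hg'⟩ := hs
  obtain rfl : g' = g := by
    ext t
    have h : HasSum (fun n : ℕ => chooseC s n * z ^ n * binomPow (x t) (s - n)) (g' t) :=
      ContinuousMap.hasSum_apply hg' t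
    rw [hg, ← h.tsum_eq, tsum_chooseC_mul_pow_mul_binomPow ((hx t).trans_lt hρ) hz, hxz]
    rfl
  exact hg'

theorem hasSum_chooseC_mul_zetaSub (hp : p ≠ 2) {z : ℂ_[p]} (hz : ‖z‖ < 1)
    (hxz : ∀ t, x t + z = x (t - 1)) (s : ℤ_[p]) :
    HasSum (fun n : ℕ => chooseC (1 - s) n * z ^ n * zetaSub x hρ hx hp (s + n))
      (binomPow (x (-1)) (1 - s) - binomPow (x 0) (1 - s) - zetaSub x hρ hx hp s) := by
  let g : C(ℤ_[p], ℂ_[p]) := (binomMap x hρ hx (1 - s)).comp ⟨fun t => t - 1, by fun_prop⟩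
  have hg : ∀ t, g t = binomMap x hρ hx (1 - s) (t - 1) := fun _ => rfl
  have h := hasSum_binomMap x hρ hx hz hxz (1 - s) hg
  have h1 := (fermionicCLM hp).hasSum h
  have h2 := h.mapL (ContinuousMap.evalCLM ℂ_[p] (0 : ℤ_[p]))
  have h3 := fermionicCLM_add_fermionicCLM_shift hp hg
  have h4 : (ContinuousMap.evalCLM ℂ_[p] (0 : ℤ_[p])) g = binomPow (x (-1)) (1 - s) := by
    change binomPow (x (0 - 1)) (1 - s) = _
    rw [zero_sub]
  have h5 : binomMap x hρ hx (1 - s) (-1) = binomPow (x (-1)) (1 - s) := rfl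
  have h6 : binomPow (x (-1)) (1 - s) - binomPow (x 0) (1 - s) - zetaSub x hρ hx hp s =
      fermionicCLM hp g - ContinuousMap.evalCLM ℂ_[p] (0 : ℤ_[p]) g := by
    rw [h4, zetaSub_apply, eq_sub_of_add_eq h3, h5]
    ring
  rw [h6]
  refine HasSum.congr_fun (h1.sub h2) fun n => ?_
  rw [zetaSub_apply, ← sub_sub, mul_sub, map_smul, map_smul]
  rfl

end binomMap

/-! ## The operator `T_p^a` -/

section operator

variable (ι : algebraicClosure ℚ ℂ →+* ℂ_[p]) (a : ℂ_[p])

/-- The product for `1 - s choose n` contains the factor `1 - s`, which `P_n` omits. At `n = 0` the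
left side is `2`, one more than the binomial term. -/
theorem sub_one_mul_coeffP {s : ℤ_[p]} (hs : s ≠ 1) (n : ℕ) :
    (toC s - 1) * coeffP ι a n (toC s) =
      chooseC (1 - s) n * (-1 / omegaV ι a) ^ n + if n = 0 then 1 else 0 := by
  have hs1 : (toC s - 1 : ℂ_[p]) ≠ 0 := fun h =>
    hs (toC_injective (by rw [toC_one]; exact sub_eq_zero.mp h))
  rcases n with _ | n
  · rw [coeffP, if_pos rfl, if_pos rfl, chooseC_eq_prod, mul_div_cancel₀ _ hs1]
    norm_num
  have h1 : coeffP ι a (n + 1) (toC s) = 1 / (((n + 1).factorial : ℂ_[p]) * omegaV ι a ^ (n + 1)) *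
      ∏ j ∈ Finset.range n, (toC s - 1 + ((j + 1 : ℕ) : ℂ_[p])) := by
    have h2 : ∏ j ∈ Finset.range n, (toC s - 1 + ((j + 1 : ℕ) : ℂ_[p])) =
        ∏ j ∈ Finset.Icc 1 (n + 1 - 1), (toC s - 1 + (j : ℂ_[p])) := by
      rw [Nat.add_sub_cancel, ← Finset.Ico_add_one_right_eq_Icc, Finset.prod_Ico_eq_prod_range,
        Nat.add_sub_cancel]
      simp only [add_comm 1]
    rw [h2, coeffP, if_neg n.succ_ne_zero]
    split_ifs with h3
    · obtain rfl : n = 0 := by omega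
      simp
    · rfl
  have h4 : ∏ i ∈ Finset.range (n + 1), (toC (1 - s) - (i : ℂ_[p])) =
      (-1) ^ (n + 1) * ((toC s - 1) * ∏ j ∈ Finset.range n, (toC s - 1 + ((j + 1 : ℕ) : ℂ_[p]))) := by
    have h5 : ∀ i : ℕ, toC (1 - s) - (i : ℂ_[p]) = -1 * (toC s - 1 + (i : ℂ_[p])) := fun i => by
      rw [toC_sub, toC_one]; ring
    simp only [h5]
    rw [Finset.prod_mul_distrib, Finset.prod_const, Finset.card_range, Finset.prod_range_succ',
      Nat.cast_zero, add_zero, mul_comm (toC s - 1 : ℂ_[p])]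
  rw [h1, chooseC_eq_prod, h4, if_neg n.succ_ne_zero, add_zero, div_pow]
  have h6 : (-1 : ℂ_[p]) ^ (n + 1) * (-1) ^ (n + 1) = 1 := by
    rw [← mul_pow]; simp
  generalize (∏ j ∈ Finset.range n, (toC s - 1 + ((j + 1 : ℕ) : ℂ_[p]))) = P
  generalize ((n + 1).factorial : ℂ_[p]) = Q
  generalize omegaV ι a ^ (n + 1) = W
  calc _ = 1 * (toC s - 1) * P / (Q * W) := by ring
    _ = ((-1 : ℂ_[p]) ^ (n + 1) * (-1) ^ (n + 1)) * (toC s - 1) * P / (Q * W) := by rw [h6]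
    _ = _ := by ring

theorem hasSum_opL_zetaSub (hp : p ≠ 2) (ha : 1 < ‖a‖) (x : C(ℤ_[p], ℂ_[p])) {ρ : ℝ} (hρ : ρ < 1)
    (hx : ∀ t, ‖x t - 1‖ ≤ ρ) (hxa : ∀ t, x t = angle ι (a + toC t)) {s : ℤ_[p]} (hs : s ≠ 1) :
    HasSum (fun n : ℕ => opL ι a n (zetaSub x hρ hx hp) s)
      (1 / (toC s - 1) * (binomPow (x (-1)) (1 - s) - binomPow (x 0) (1 - s))) := by
  have hs1 : (toC s - 1 : ℂ_[p]) ≠ 0 := fun h =>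
    hs (toC_injective (by rw [toC_one]; exact sub_eq_zero.mp h))
  have ha0 : a ≠ 0 := norm_pos_iff.mp (one_pos.trans ha)
  have hz : ‖-1 / omegaV ι a‖ < 1 := by
    rw [norm_div, norm_neg, norm_one, norm_omegaV ι ha0]
    exact (div_lt_one (one_pos.trans ha)).mpr ha
  have hxz : ∀ t, x t + -1 / omegaV ι a = x (t - 1) := fun t => by
    rw [hxa, hxa, angle_add ι ha (norm_toC_le_one t), angle_add ι ha (norm_toC_le_one _), toC_sub,
      toC_one]
    ring
  set F := zetaSub x hρ hx hp
  -- The surplus `1` at `n = 0` contributes `F s` and cancels the `-F s` in the limit.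
  have h := (hasSum_chooseC_mul_zetaSub x hρ hx hp hz hxz s).add (hasSum_ite_eq (0 : ℕ) (F s))
  rw [sub_add_cancel] at h
  refine HasSum.congr_fun (h.mul_left (1 / (toC s - 1 : ℂ_[p]))) fun n => ?_
  have h2 := sub_one_mul_coeffP ι a hs n
  rw [opL, expD_apply, one_div, eq_inv_mul_iff_mul_eq₀ hs1, ← mul_assoc, h2, add_mul]
  congr 1
  split_ifs with h0
  · rw [h0, Nat.cast_zero, add_zero, one_mul]
  · rw [zero_mul]

end operator

/-! ## Power series expansions of Mahler series -/

variable (p) in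
/-- The real number `p ^ (1 / (p - 1))`. -/
def expRadiusInv : ℝ := (p : ℝ) ^ ((p - 1 : ℕ) : ℝ)⁻¹

theorem one_le_expRadiusInv : 1 ≤ expRadiusInv p :=
  Real.one_le_rpow (by exact_mod_cast (Fact.out : p.Prime).one_lt.le) (by positivity)

theorem expRadiusInv_pow : expRadiusInv p ^ (p - 1) = p :=
  Real.rpow_inv_natCast_pow (Nat.cast_nonneg p)
    (Nat.sub_ne_zero_of_lt (Fact.out : p.Prime).one_lt)

/-- Legendre's formula: `(p - 1) v_p(n!)` is `n` minus the digit sum of `n` in base `p`. -/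
theorem norm_inv_factorial_le (n : ℕ) : ‖((n.factorial : ℂ_[p]))⁻¹‖ ≤ expRadiusInv p ^ n := by
  have h0 : ((n.factorial : ℕ) : ℚ_[p]) ≠ 0 := Nat.cast_ne_zero.mpr n.factorial_ne_zero
  rw [norm_inv, ← map_natCast (algebraMap ℚ_[p] ℂ_[p]), norm_algebraMap',
    Padic.norm_eq_zpow_neg_valuation h0, Padic.valuation_natCast, zpow_neg, inv_inv, zpow_natCast]
  conv_lhs => rw [← expRadiusInv_pow (p := p), ← pow_mul]
  refine pow_le_pow_right₀ one_le_expRadiusInv ?_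
  rw [sub_one_mul_padicValNat_factorial]
  exact Nat.sub_le _ _

theorem chooseC_eq_sum (s : ℤ_[p]) (n : ℕ) : (chooseC s n : ℂ_[p]) =
    ∑ k ∈ Finset.range (n + 1),
      (((descPochhammer ℤ n).coeff k : ℤ) : ℂ_[p]) / (n.factorial : ℂ_[p]) * toC s ^ k := by
  have h : (descPochhammer ℂ_[p] n).natDegree < n + 1 := by
    rw [descPochhammer_natDegree]; exact Nat.lt_succ_self n
  rw [chooseC_eq_prod, ← descPochhammer_eval_eq_prod_range, eval_eq_sum_range' h, Finset.sum_div]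
  refine Finset.sum_congr rfl fun k _ => ?_
  rw [← descPochhammer_map (Int.castRingHom ℂ_[p]), coeff_map, eq_intCast]
  ring

theorem norm_intCast_le_one (z : ℤ) : ‖(z : ℂ_[p])‖ ≤ 1 := by
  rw [← map_intCast (algebraMap ℚ_[p] ℂ_[p]), norm_algebraMap']
  exact Padic.norm_int_le_one z

/-- A Mahler series with rapidly decreasing coefficients is a power series. -/
theorem exists_hasSum_pow_of_norm_le {c : ℕ → ℂ_[p]} {ρ : ℝ} (hρ0 : 0 ≤ ρ)
    (hρ : ρ * expRadiusInv p < 1) (hc : ∀ n, ‖c n‖ ≤ ρ ^ n) :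
    ∃ d : ℕ → ℂ_[p], (∀ k, ‖d k‖ ≤ 1) ∧
      ∀ v : ℤ_[p], HasSum (fun k => d k * toC v ^ k) (∑' n, chooseC v n * c n) := by
  set θ := ρ * expRadiusInv p
  have hθ0 : 0 ≤ θ := mul_nonneg hρ0 (zero_le_one.trans one_le_expRadiusInv)
  -- The entries are bounded by `θ^n` and vanish for `k > n`. Splitting `θ^n` as `σ^n σ^n ≤ σ^n σ^k`
  -- makes the double family summable, so the order of summation can be exchanged.
  set σ := √θ
  have hσ0 : 0 ≤ σ := Real.sqrt_nonneg θ
  have hσ1 : σ < 1 := by rw [Real.sqrt_lt' one_pos]; simpa using hρ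
  have hσθ : σ * σ = θ := Real.mul_self_sqrt hθ0
  let A : ℕ → ℕ → ℂ_[p] := fun n k =>
    c n * ((((descPochhammer ℤ n).coeff k : ℤ) : ℂ_[p]) / (n.factorial : ℂ_[p]))
  have hA0 : ∀ n k, n < k → A n k = 0 := fun n k h => by
    have : (descPochhammer ℤ n).coeff k = 0 :=
      coeff_eq_zero_of_natDegree_lt (by rwa [descPochhammer_natDegree])
    simp [A, this]
  have hA : ∀ n k, ‖A n k‖ ≤ σ ^ n * σ ^ k := fun n k => by
    rcases lt_or_ge n k with h | h
    · rw [hA0 n k h, norm_zero]; positivity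
    · calc ‖A n k‖ = ‖c n‖ *
            (‖(((descPochhammer ℤ n).coeff k : ℤ) : ℂ_[p])‖ * ‖((n.factorial : ℂ_[p]))⁻¹‖) := by
            simp only [A, div_eq_mul_inv, norm_mul]
        _ ≤ ρ ^ n * (1 * expRadiusInv p ^ n) := by
            gcongr
            · exact hc n
            · exact norm_intCast_le_one _
            · exact norm_inv_factorial_le n
        _ = σ ^ n * σ ^ n := by rw [one_mul, ← mul_pow, ← mul_pow, hσθ]
        _ ≤ σ ^ n * σ ^ k := by
            gcongr ?_ * ?_
            exact pow_le_pow_of_le_one hσ0 hσ1.le h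
  refine ⟨fun k => ∑' n, A n k, fun k => ?_, fun v => ?_⟩
  · refine IsUltrametricDist.norm_tsum_le_of_forall_le fun n => (hA n k).trans ?_
    exact mul_le_one₀ (pow_le_one₀ hσ0 hσ1.le) (by positivity) (pow_le_one₀ hσ0 hσ1.le)
  have hgeo := summable_geometric_of_lt_one hσ0 hσ1
  have hB : Summable (fun q : ℕ × ℕ => A q.1 q.2 * toC v ^ q.2) := by
    refine Summable.of_norm_bounded (hgeo.mul_of_nonneg hgeo (fun n => pow_nonneg hσ0 n)
      (fun n => pow_nonneg hσ0 n)) fun q => ?_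
    rw [norm_mul, norm_pow]
    exact (mul_le_of_le_one_right (norm_nonneg _)
      (pow_le_one₀ (norm_nonneg _) (norm_toC_le_one v))).trans (hA _ _)
  have h1 : ∑' n, chooseC v n * c n = ∑' q : ℕ × ℕ, A q.1 q.2 * toC v ^ q.2 := by
    rw [hB.tsum_prod]
    refine tsum_congr fun n => ?_
    rw [tsum_eq_sum (s := Finset.range (n + 1)), chooseC_eq_sum, Finset.sum_mul]
    · refine Finset.sum_congr rfl fun k _ => ?_
      simp only [A]
      ring
    · intro k hk
      rw [hA0 n k (by simpa using hk), zero_mul]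
  rw [h1]
  have h2 := hB.prod_symm.hasSum.prod_fiberwise fun k => (hB.prod_symm.prod_factor k).hasSum
  rw [← (Equiv.prodComm ℕ ℕ).tsum_eq]
  refine HasSum.congr_fun h2 fun k => ?_
  exact tsum_mul_right.symm

/-! ## Taylor expansions -/

theorem extendZero_coe (f : ℤ_[p] → ℂ_[p]) (s : ℤ_[p]) : extendZero f (s : ℚ_[p]) = f s := by
  exact dif_pos s.property

section taylor

variable {f : ℤ_[p] → ℂ_[p]} {s : ℤ_[p]} {m : ℕ} {e : ℕ → ℂ_[p]}

theorem hasFPowerSeriesOnBall_extendZero (he : ∀ k, ‖e k‖ ≤ (p : ℝ) ^ (m * k))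
    (hf : ∀ t : ℤ_[p], (p : ℤ_[p]) ^ m ∣ t → HasSum (fun k => e k * toC t ^ k) (f (s + t))) :
    HasFPowerSeriesOnBall (extendZero f)
      (fun k => ContinuousMultilinearMap.mkPiRing ℚ_[p] (Fin k) (e k)) (s : ℚ_[p])
      (((p : NNReal)⁻¹ ^ m : NNReal) : ENNReal) where
  r_le := by
    refine FormalMultilinearSeries.le_radius_of_bound _ 1 fun k => ?_
    have hp : (0 : ℝ) < p := Nat.cast_pos.mpr (Fact.out : p.Prime).pos
    rw [ContinuousMultilinearMap.norm_mkPiRing]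
    push_cast
    rw [← pow_mul, inv_pow]
    exact (mul_inv_le_iff₀ (by positivity)).mpr (by simpa using he k)
  r_pos := by
    have hp : (0 : NNReal) < p := Nat.cast_pos.mpr (Fact.out : p.Prime).pos
    exact ENNReal.coe_pos.mpr (by positivity)
  hasSum := by
    intro y hy
    have hy1 : ‖y‖ < (p : ℝ)⁻¹ ^ m := by
      have h : ‖y‖₊ < (p : NNReal)⁻¹ ^ m := by
        rwa [Metric.mem_eball, edist_zero_right, enorm_eq_nnnorm, ENNReal.coe_lt_coe] at hy
      exact_mod_cast h
    have hy2 : ‖y‖ ≤ 1 := hy1.le.trans (pow_le_one₀ (by positivity) inv_prime_lt_one.le)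
    let t : ℤ_[p] := ⟨y, hy2⟩
    have ht : (p : ℤ_[p]) ^ m ∣ t := by
      rw [← Ideal.mem_span_singleton, ← PadicInt.norm_le_pow_iff_mem_span_pow, zpow_neg,
        zpow_natCast, ← inv_pow]
      exact hy1.le
    have h := hf t ht
    have h1 : extendZero f ((s : ℚ_[p]) + y) = f (s + t) := by
      rw [← extendZero_coe f (s + t)]
      rfl
    rw [h1]
    refine HasSum.congr_fun h fun k => ?_
    simp only [ContinuousMultilinearMap.mkPiRing_apply, Finset.prod_const, Finset.card_univ,
      Fintype.card_fin, Algebra.smul_def, map_pow]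
    rw [mul_comm]
    rfl

/-- The expansion on the open ball of radius `p^(-m)` serves only to identify `k! e k` with the
derivatives. Convergence on the closed ball `p^m ℤ_[p]` is the hypothesis `hf`; for `m = 0` this
gives all of `ℤ_[p]`. -/
theorem hasSum_expDTerm (he : ∀ k, ‖e k‖ ≤ (p : ℝ) ^ (m * k))
    (hf : ∀ t : ℤ_[p], (p : ℤ_[p]) ^ m ∣ t → HasSum (fun k => e k * toC t ^ k) (f (s + t)))
    {t : ℤ_[p]} (ht : (p : ℤ_[p]) ^ m ∣ t) : HasSum (expDTerm t f s) (f (s + t)) := by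
  refine HasSum.congr_fun (hf t ht) fun k => ?_
  have h := (hasFPowerSeriesOnBall_extendZero he hf).factorial_smul 1 k
  have h2 : iterD k f s = (k.factorial : ℂ_[p]) * e k := by
    rw [iterD, iteratedDeriv_eq_iteratedFDeriv]
    refine h.symm.trans ?_
    simp
  have hk : ((k.factorial : ℕ) : ℂ_[p]) ≠ 0 := Nat.cast_ne_zero.mpr k.factorial_ne_zero
  rw [expDTerm, h2]
  field_simp

end taylor

theorem contDiffOn_extendZero {f : ℤ_[p] → ℂ_[p]} (h : ∀ s : ℤ_[p], ∃ m : ℕ, ∃ e : ℕ → ℂ_[p],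
    (∀ k, ‖e k‖ ≤ (p : ℝ) ^ (m * k)) ∧
      ∀ t : ℤ_[p], (p : ℤ_[p]) ^ m ∣ t → HasSum (fun k => e k * toC t ^ k) (f (s + t)))
    (n : WithTop ℕ∞) : ContDiffOn ℚ_[p] n (extendZero f) (Metric.closedBall 0 1) := by
  intro y hy
  rw [mem_closedBall_zero_iff] at hy
  obtain ⟨m, e, he, hf⟩ := h ⟨y, hy⟩
  exact (hasFPowerSeriesOnBall_extendZero he hf).analyticAt.contDiffAt.contDiffWithinAt

/-! ### Local power series of the zeta function -/

section zetaSub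

variable (x : C(ℤ_[p], ℂ_[p])) {ρ : ℝ} (hρ : ρ < 1) (hx : ∀ t, ‖x t - 1‖ ≤ ρ)

theorem hasSum_binomMap_add {m : ℕ} {ρ' : ℝ} (hρ' : ρ' < 1)
    (hxm : ∀ t, ‖x t ^ p ^ m - 1‖ ≤ ρ') (s v : ℤ_[p]) :
    HasSum (fun n : ℕ => chooseC v n • (binomMap x hρ hx s * (x ^ p ^ m - 1) ^ n))
      (binomMap x hρ hx (s + p ^ m * v)) := by
  have hρ'0 : 0 ≤ ρ' := (norm_nonneg _).trans (hxm 0)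
  have hs : Summable (fun n : ℕ => chooseC v n • (binomMap x hρ hx s * (x ^ p ^ m - 1) ^ n)) := by
    refine Summable.of_norm_bounded (summable_geometric_of_lt_one hρ'0 hρ') fun n => ?_
    refine (ContinuousMap.norm_le _ (by positivity)).mpr fun t => ?_
    change ‖chooseC v n * (binomPow (x t) s * (x t ^ p ^ m - 1) ^ n)‖ ≤ ρ' ^ n
    rw [mul_left_comm, norm_mul]
    exact (mul_le_of_le_one_left (norm_nonneg _) (norm_binomPow_le ((hx t).trans_lt hρ) s)).trans
      (norm_chooseC_mul_pow_le (hxm t) v n)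
  obtain ⟨g, hg⟩ := hs
  obtain rfl : g = binomMap x hρ hx (s + p ^ m * v) := by
    ext t
    have h : HasSum (fun n : ℕ => chooseC v n * (binomPow (x t) s * (x t ^ p ^ m - 1) ^ n)) (g t) :=
      ContinuousMap.hasSum_apply hg t
    rw [← h.tsum_eq]
    change _ = binomPow (x t) (s + p ^ m * v)
    rw [binomPow_add_mul_pow ((hx t).trans_lt hρ) m ((hxm t).trans_lt hρ')]
    rw [binomPow.eq_1 (x t ^ p ^ m), ← tsum_mul_left]
    exact tsum_congr fun n => mul_left_comm _ _ _
  exact hg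

theorem exists_hasSum_pow_zetaSub (hp : p ≠ 2) {m : ℕ} {ρ' : ℝ} (hρ' : ρ' * expRadiusInv p < 1)
    (hxm : ∀ t, ‖x t ^ p ^ m - 1‖ ≤ ρ') (s : ℤ_[p]) :
    ∃ e : ℕ → ℂ_[p], (∀ k, ‖e k‖ ≤ (p : ℝ) ^ (m * k)) ∧
      ∀ t : ℤ_[p], (p : ℤ_[p]) ^ m ∣ t →
        HasSum (fun k => e k * toC t ^ k) (zetaSub x hρ hx hp (s + t)) := by
  have hρ'0 : 0 ≤ ρ' := (norm_nonneg _).trans (hxm 0)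
  have hρ'1 : ρ' < 1 := (le_mul_of_one_le_right hρ'0 one_le_expRadiusInv).trans_lt hρ'
  let E : ℕ → C(ℤ_[p], ℂ_[p]) := fun n => binomMap x hρ hx (1 - s) * (x ^ p ^ m - 1) ^ n
  have hE : ∀ n, ‖E n‖ ≤ ρ' ^ n := fun n => by
    refine (ContinuousMap.norm_le _ (by positivity)).mpr fun t => ?_
    change ‖binomPow (x t) (1 - s) * (x t ^ p ^ m - 1) ^ n‖ ≤ ρ' ^ n
    rw [norm_mul, norm_pow]
    exact (mul_le_of_le_one_left (by positivity)
      (norm_binomPow_le ((hx t).trans_lt hρ) _)).trans (pow_le_pow_left₀ (norm_nonneg _) (hxm t) n)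
  let c : ℕ → ℂ_[p] := fun n => fermionicCLM hp (E n) - E n 0
  have hc : ∀ n, ‖c n‖ ≤ ρ' ^ n := fun n =>
    (norm_sub_le_max' _ _).trans (max_le ((norm_fermionicCLM_apply_le hp _).trans (hE n))
      (((E n).norm_coe_le_norm 0).trans (hE n)))
  have hF : ∀ v : ℤ_[p], ∑' n, chooseC v n * c n = zetaSub x hρ hx hp (s - p ^ m * v) := by
    intro v
    have h := hasSum_binomMap_add x hρ hx hρ'1 hxm (1 - s) v
    have h3 := ((fermionicCLM hp).hasSum h).sub
      (h.mapL (ContinuousMap.evalCLM ℂ_[p] (0 : ℤ_[p])))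
    have h4 : HasSum (fun n => chooseC v n * c n) (zetaSub x hρ hx hp (s - p ^ m * v)) := by
      have h5 : (1 : ℤ_[p]) - (s - p ^ m * v) = 1 - s + p ^ m * v := by ring
      rw [zetaSub_apply, h5]
      refine HasSum.congr_fun h3 fun n => ?_
      rw [map_smul, mul_sub, smul_eq_mul]
      rfl
    exact h4.tsum_eq
  obtain ⟨d, hd, hsum⟩ := exists_hasSum_pow_of_norm_le hρ'0 hρ' hc
  have hp0 : (p : ℂ_[p]) ≠ 0 := Nat.cast_ne_zero.mpr (Fact.out : p.Prime).ne_zero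
  -- The exponent is `1 - s`, so the shift `s + t` corresponds to `v = -t / p^m` in the Mahler
  -- variable.
  refine ⟨fun k => d k * (-((p : ℂ_[p]) ^ m)⁻¹) ^ k, fun k => ?_, ?_⟩
  · rw [norm_mul, norm_pow, norm_neg, norm_inv, norm_pow, norm_natCast_prime,
      inv_pow (p : ℝ) m, inv_inv, ← pow_mul]
    exact mul_le_of_le_one_left (by positivity) (hd k)
  · rintro _ ⟨v, rfl⟩
    have h := hsum (-v)
    rw [hF, mul_neg, sub_neg_eq_add] at h
    refine HasSum.congr_fun h fun k => ?_
    rw [toC_mul, toC_pow, toC_natCast, toC_neg, mul_assoc, ← mul_pow]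
    congr 2
    field_simp

theorem exists_norm_pow_prime_pow_sub_one_le (hx : ∀ t, ‖x t - 1‖ ≤ ρ) (hρ : ρ < 1) :
    ∃ m : ℕ, ∃ ρ' : ℝ, ρ' * expRadiusInv p < 1 ∧ ∀ t, ‖x t ^ p ^ m - 1‖ ≤ ρ' := by
  have h0 : 0 < expRadiusInv p := one_pos.trans_le one_le_expRadiusInv
  have h1 : max ρ (p : ℝ)⁻¹ < 1 := max_lt hρ inv_prime_lt_one
  have h2 : 0 ≤ max ρ (p : ℝ)⁻¹ := le_max_of_le_right (by positivity)
  obtain ⟨m, hm⟩ := exists_pow_lt_of_lt_one (inv_pos.mpr h0) h1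
  -- The contraction rate of `p`-th powers near `1` is never better than `p⁻¹`, whence the maximum;
  -- `m` is uniform in `t`.
  refine ⟨m, max ρ (p : ℝ)⁻¹ ^ (m + 1), ?_, fun t =>
    norm_pow_prime_pow_sub_one_le h1.le (le_max_right _ _) ((hx t).trans (le_max_left _ _)) m⟩
  refine (lt_inv_mul_iff₀' h0).mp ?_
  rw [mul_one]
  exact (pow_le_pow_of_le_one h2 h1.le (Nat.le_succ m)).trans_lt hm

end zetaSub

/-! ## Value groups of finite extensions -/

/-- An infinite index is recorded as `0`, which would satisfy any upper bound on the ramification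
index. This rules it out for a cyclic group with a power of its generator in `H`. -/
theorem relIndex_zpowers_ne_zero {G : Type*} [Group G] {H : Subgroup G} {g : G} {d : ℕ}
    (hd : d ≠ 0) (h : g ^ d ∈ H) : H.relIndex (Subgroup.zpowers g) ≠ 0 := by
  have h1 : (zpowersHom G g).range = Subgroup.zpowers g := by
    ext y
    rfl
  rw [← h1, ← Subgroup.index_comap]
  have h2 : AddSubgroup.toSubgroup (AddSubgroup.zmultiples (d : ℤ)) ≤
      H.comap (zpowersHom G g) := by
    rintro _ ⟨k, rfl⟩
    change g ^ (k • (d : ℤ)) ∈ H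
    rw [smul_eq_mul, mul_comm, zpow_mul, zpow_natCast]
    exact H.zpow_mem h k
  have h3 : (AddSubgroup.toSubgroup (AddSubgroup.zmultiples (d : ℤ))).index ≠ 0 := by
    rw [AddSubgroup.index_toSubgroup, Int.index_zmultiples]
    simpa using hd
  exact ne_zero_of_dvd_ne_zero h3 (Subgroup.index_dvd_of_le h2)

theorem mem_valueGroup_iff {K : IntermediateField ℚ_[p] ℂ_[p]} {g : ℝˣ} :
    g ∈ valueGroup K ↔ ∃ y ∈ K, y ≠ 0 ∧ ‖y‖ = g := by
  constructor
  · rintro ⟨y, rfl⟩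
    exact ⟨(y : K), (y : K).2, by simp, rfl⟩
  · rintro ⟨y, hy, hy0, h⟩
    refine ⟨Units.mk0 ⟨y, hy⟩ fun h0 => hy0 (congrArg Subtype.val h0), Units.ext h⟩

theorem exists_norm_pow_eq_zpow_of_mem_bot {y : ℂ_[p]}
    (hy : y ∈ (⊥ : IntermediateField ℚ_[p] ℂ_[p])) (hy0 : y ≠ 0) :
    ∃ z : ℤ, ‖y‖ = (p : ℝ) ^ z := by
  obtain ⟨q, rfl⟩ := IntermediateField.mem_bot.mp hy
  have hq : q ≠ 0 := fun h => hy0 (by rw [h, map_zero])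
  exact ⟨-q.valuation, by rw [norm_algebraMap', Padic.norm_eq_zpow_neg_valuation hq]⟩

section finite

variable (K : IntermediateField ℚ_[p] ℂ_[p]) [FiniteDimensional ℚ_[p] K]

theorem ramificationIndex_ne_zero : ramificationIndex K ≠ 0 := by
  have hp : (0 : ℝ) < p := Nat.cast_pos.mpr (Fact.out : p.Prime).pos
  set d := Module.finrank ℚ_[p] K
  have hd : d ≠ 0 := Module.finrank_pos.ne'
  -- Degrees of minimal polynomials divide `d`, so every norm from `Kˣ` is an integral power of
  -- `p^(1/d)`.
  let γ : ℝˣ := Units.mk0 ((p : ℝ) ^ (d : ℝ)⁻¹) (by positivity)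
  have hγ0 : 0 < (γ : ℝ) := Real.rpow_pos_of_pos hp _
  have hγ : (γ : ℝ) ^ d = p := Real.rpow_inv_natCast_pow hp.le hd
  have h1 : γ ^ d ∈ valueGroup (⊥ : IntermediateField ℚ_[p] ℂ_[p]) := by
    refine mem_valueGroup_iff.mpr ⟨(p : ℂ_[p])⁻¹, inv_mem (natCast_mem _ p), ?_, ?_⟩
    · exact inv_ne_zero (Nat.cast_ne_zero.mpr (Fact.out : p.Prime).ne_zero)
    · rw [norm_inv, norm_natCast_prime, inv_inv, Units.val_pow_eq_pow_val, hγ]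
  have h2 : valueGroup K ≤ Subgroup.zpowers γ := by
    intro g hg
    obtain ⟨y, hy, hy0, hyg⟩ := mem_valueGroup_iff.mp hg
    let w : K := ⟨y, hy⟩
    have hw0 : w ≠ 0 := fun h => hy0 (congrArg Subtype.val h)
    have hint : IsIntegral ℚ_[p] w := Algebra.IsIntegral.isIntegral w
    obtain ⟨c, hc⟩ := minpoly.degree_dvd hint
    have h3 := norm_pow_natDegree_minpoly (p := p) w
    rw [Padic.norm_eq_zpow_neg_valuation (minpoly.coeff_zero_ne_zero hint hw0)] at h3
    set v := ((minpoly ℚ_[p] w).coeff 0).valuation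
    have h4 : ‖y‖ ^ d = ((γ : ℝ) ^ (-v * c)) ^ d := by
      have h5 : ‖y‖ ^ d = ((p : ℝ) ^ (-v)) ^ c := by
        rw [← h3, ← pow_mul]
        exact congrArg (‖y‖ ^ ·) hc
      rw [h5, ← hγ, ← zpow_natCast, ← zpow_natCast, ← zpow_natCast, ← zpow_mul, ← zpow_mul,
        ← zpow_mul]
      congr 1
      ring
    have h6 := (pow_left_inj₀ (norm_nonneg _) (zpow_nonneg hγ0.le _) hd).mp h4
    exact ⟨-v * c, Units.ext (by rw [← hyg, h6, Units.val_zpow_eq_zpow_val])⟩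
  intro h0
  exact relIndex_zpowers_ne_zero hd h1 (Subgroup.relIndex_eq_zero_of_le_right h2 h0)

variable {K}

theorem exists_norm_pow_eq_zpow {y : ℂ_[p]} (hy : y ∈ K) (hy0 : y ≠ 0) :
    ∃ n : ℕ, 0 < n ∧ n ≤ ramificationIndex K ∧ ∃ z : ℤ, ‖y‖ ^ n = (p : ℝ) ^ z := by
  obtain ⟨n, hn0, hn, hmem⟩ := Subgroup.exists_pow_mem_of_relIndex_ne_zero
    (ramificationIndex_ne_zero K) (a := Units.mk0 ‖y‖ (norm_ne_zero_iff.mpr hy0))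
    (mem_valueGroup_iff.mpr ⟨y, hy, hy0, rfl⟩)
  obtain ⟨u, hu, hu0, hnorm⟩ := mem_valueGroup_iff.mp hmem.1
  obtain ⟨z, hz⟩ := exists_norm_pow_eq_zpow_of_mem_bot hu hu0
  exact ⟨n, hn0, hn, z, by rw [← hz, hnorm]; rfl⟩

/-- Some `‖y‖^n` with `n < p - 1` is an integral power of `p` below `1`, so `‖y‖ ≤ p^(-1/n) <
p^(-1/(p-1))`. -/
theorem norm_mul_expRadiusInv_lt_one (hK : ramificationIndex K < p - 1) {y : ℂ_[p]} (hy : y ∈ K)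
    (hy1 : ‖y‖ < 1) : ‖y‖ * expRadiusInv p < 1 := by
  rcases eq_or_ne y 0 with rfl | hy0
  · simp
  have hp1 : (1 : ℝ) < p := by exact_mod_cast (Fact.out : p.Prime).one_lt
  have hp : (0 : ℝ) < p := one_pos.trans hp1
  obtain ⟨n, hn0, hn, z, hz⟩ := exists_norm_pow_eq_zpow hy hy0
  have hτ : 1 < expRadiusInv p :=
    Real.one_lt_rpow hp1 (inv_pos.mpr (Nat.cast_pos.mpr (by omega)))
  have hz1 : z ≤ -1 := by
    have h : (p : ℝ) ^ z < 1 := hz ▸ pow_lt_one₀ (norm_nonneg _) hy1 hn0.ne'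
    have := (zpow_lt_one_iff_right₀ hp1).mp h
    omega
  refine (pow_lt_one_iff_of_nonneg (by positivity) hn0.ne').mp ?_
  rw [mul_pow, hz]
  calc (p : ℝ) ^ z * expRadiusInv p ^ n ≤ (p : ℝ) ^ (-1 : ℤ) * expRadiusInv p ^ n := by
        gcongr
        exact hp1.le
    _ < (p : ℝ) ^ (-1 : ℤ) * expRadiusInv p ^ (p - 1) := by
        exact mul_lt_mul_of_pos_left (pow_lt_pow_right₀ hτ (hn.trans_lt hK)) (by positivity)
    _ = 1 := by
        rw [expRadiusInv_pow, zpow_neg_one, inv_mul_cancel₀ hp.ne']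

theorem isClosed_intermediateField : IsClosed (K : Set ℂ_[p]) :=
  have : FiniteDimensional ℚ_[p] K.toSubalgebra.toSubmodule :=
    inferInstanceAs (FiniteDimensional ℚ_[p] K)
  Submodule.closed_of_finiteDimensional K.toSubalgebra.toSubmodule

/-- Teichmüller representatives of elements of `K` lie in `K`. -/
theorem mem_of_isPrimeToPRootOfUnity {w ζ : ℂ_[p]} (hw : w ∈ K) (hζ : IsPrimeToPRootOfUnity ζ)
    (h : ‖w / ζ - 1‖ < 1) : ζ ∈ K := by
  have hζ0 : ζ ≠ 0 := norm_ne_zero_iff.mp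
    (by rw [norm_eq_one_of_isPrimeToPRootOfUnity hζ]; exact one_ne_zero)
  obtain ⟨m, hm, hpm, hζm⟩ := hζ
  have hco : Nat.Coprime p m := (Nat.Prime.coprime_iff_not_dvd Fact.out).mpr hpm
  have hf : 0 < m.totient := Nat.totient_pos.mpr hm
  -- Euler's theorem fixes `ζ` under these powers while those of `w / ζ` tend to `1`; so the powers
  -- of `w` tend to `ζ`, and `K` is closed.
  have hfix : ∀ k : ℕ, ζ ^ p ^ (m.totient * k) = ζ := by
    intro k
    have h1 : p ^ (m.totient * k) ≡ 1 [MOD m] := by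
      rw [pow_mul]
      simpa using (Nat.ModEq.pow_totient hco).pow k
    have h2 := pow_eq_pow_of_modEq h1 hζm
    rwa [pow_one] at h2
  set ρ := max ‖w / ζ - 1‖ (p : ℝ)⁻¹
  have hρ : ρ < 1 := max_lt h inv_prime_lt_one
  have hlim : Tendsto (fun k : ℕ => w ^ p ^ (m.totient * k)) atTop (𝓝 ζ) := by
    rw [tendsto_iff_norm_sub_tendsto_zero]
    refine squeeze_zero (fun _ => norm_nonneg _) (fun k => ?_)
      ((tendsto_pow_atTop_nhds_zero_of_lt_one (le_max_of_le_left (norm_nonneg _)) hρ).comp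
        (tendsto_add_atTop_nat 1))
    have h3 : w ^ p ^ (m.totient * k) - ζ = ((w / ζ) ^ p ^ (m.totient * k) - 1) * ζ := by
      rw [div_pow, hfix]
      field_simp
    have h4 : ‖ζ‖ = 1 := norm_eq_one_of_isPrimeToPRootOfUnity ⟨m, hm, hpm, hζm⟩
    rw [h3, norm_mul, h4, mul_one]
    refine (norm_pow_prime_pow_sub_one_le hρ.le (le_max_right _ _) (le_max_left _ _) _).trans ?_
    exact pow_le_pow_of_le_one (le_max_of_le_left (norm_nonneg _)) hρ.le
      (Nat.succ_le_succ (Nat.le_mul_of_pos_left k hf))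
  exact isClosed_intermediateField.mem_of_tendsto hlim (Eventually.of_forall fun k => pow_mem hw _)

theorem norm_pow_sub_one_le {x : ℂ_[p]} (hx : ‖x - 1‖ < 1) (n : ℕ) : ‖x ^ n - 1‖ ≤ ‖x - 1‖ := by
  have h1 : ‖x‖ = 1 := by simpa using norm_eq_of_norm_sub_lt (y := (1 : ℂ_[p])) (by simpa using hx)
  rw [← geom_sum_mul, norm_mul]
  refine mul_le_of_le_one_left (norm_nonneg _) ?_
  exact IsUltrametricDist.norm_sum_le_of_forall_le_of_nonneg zero_le_one fun k _ => by
    rw [norm_pow, h1, one_pow]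

/-- The cofactor `1 + x + ... + x^(n-1)` is congruent to `n` modulo the maximal ideal, hence a unit.
-/
theorem norm_pow_sub_one_eq {x : ℂ_[p]} (hx : ‖x - 1‖ < 1) {n : ℕ} (hn : ¬ p ∣ n) :
    ‖x ^ n - 1‖ = ‖x - 1‖ := by
  have h1 : ‖∑ i ∈ Finset.range n, x ^ i - n‖ < 1 := by
    have h2 : ∑ i ∈ Finset.range n, x ^ i - (n : ℂ_[p]) = ∑ i ∈ Finset.range n, (x ^ i - 1) := by
      simp
    rw [h2]
    exact (IsUltrametricDist.norm_sum_le_of_forall_le_of_nonneg (norm_nonneg _)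
      fun k _ => norm_pow_sub_one_le hx k).trans_lt hx
  have h3 := norm_eq_of_norm_sub_lt (h1.trans_eq (norm_natCast_of_not_dvd hn).symm)
  rw [← geom_sum_mul, norm_mul, h3, norm_natCast_of_not_dvd hn, one_mul]

end finite

theorem ratPow_pow (ι : algebraicClosure ℚ ℂ →+* ℂ_[p]) (r : ℚ) (n : ℕ) :
    ratPow ι r ^ n = ratPow ι (n * r) := by
  induction n with
  | zero => simp [ratPow_zero]
  | succ n ih => rw [pow_succ, ih, ← ratPow_add]; congr 1; push_cast; ring

theorem ratPow_intCast (ι : algebraicClosure ℚ ℂ →+* ℂ_[p]) (z : ℤ) :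
    ratPow ι z = (p : ℂ_[p]) ^ z := by
  simpa using ratPow_pow_den ι (z : ℚ)

theorem IsPrimeToPRootOfUnity.pow {ζ : ℂ_[p]} (h : IsPrimeToPRootOfUnity ζ) (n : ℕ) :
    IsPrimeToPRootOfUnity (ζ ^ n) := by
  obtain ⟨m, hm, hpm, h1⟩ := h
  exact ⟨m, hm, hpm, by rw [← pow_mul, mul_comm, pow_mul, h1, one_pow]⟩

/-- The root `p^(v_p(a))` need not lie in `K`, so neither need `⟨a⟩`. A power `⟨a⟩^n` with `0 < n <
p - 1` does, and raising to a power prime to `p` preserves the distance from `1`. -/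
theorem norm_angle_sub_one_mul_expRadiusInv_lt_one (ι : algebraicClosure ℚ ℂ →+* ℂ_[p])
    {K : IntermediateField ℚ_[p] ℂ_[p]} [FiniteDimensional ℚ_[p] K]
    (hK : ramificationIndex K < p - 1) {a : ℂ_[p]} (haK : a ∈ K) (ha : a ≠ 0) :
    ‖angle ι a - 1‖ * expRadiusInv p < 1 := by
  have hp1 : (1 : ℝ) < p := by exact_mod_cast (Fact.out : p.Prime).one_lt
  obtain ⟨n, hn0, hn, z, hz⟩ := exists_norm_pow_eq_zpow haK ha
  have hpn : ¬ p ∣ n := fun h => by have := Nat.le_of_dvd hn0 h; omega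
  have hr : ratPow ι (vp a) ^ n = (p : ℂ_[p]) ^ (-z) := by
    rw [ratPow_pow, ← ratPow_intCast ι]
    congr 1
    have h1 : (p : ℝ) ^ (-(vp a : ℝ) * n) = (p : ℝ) ^ (z : ℝ) := by
      rw [Real.rpow_mul (Nat.cast_nonneg p), Real.rpow_natCast, ← norm_eq_rpow_vp ha, hz,
        Real.rpow_intCast]
    have h2 := (Real.rpow_right_inj (one_pos.trans hp1) hp1.ne').mp h1
    have h3 : -(vp a) * n = (z : ℚ) := by exact_mod_cast h2
    push_cast
    linarith
  have hx := norm_angle_sub_one_lt ι ha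
  set w := a ^ n * (p : ℂ_[p]) ^ z
  have hwK : w ∈ K := mul_mem (pow_mem haK n) (zpow_mem (natCast_mem K p) z)
  have hw : angle ι a ^ n = w / teich ι a ^ n := by
    rw [angle_eq_div, omegaV, div_pow, mul_pow, hr, zpow_neg, div_mul_eq_div_div, div_inv_eq_mul]
  have hxn := norm_pow_sub_one_eq hx hpn
  have hζ := mem_of_isPrimeToPRootOfUnity hwK ((teich_spec ι ha).1.pow n)
    (by rw [← hw, hxn]; exact hx)
  rw [← hxn]
  refine norm_mul_expRadiusInv_lt_one hK ?_ (by rwa [hxn])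
  rw [hw]
  exact sub_mem (div_mem hwK hζ) (one_mem K)

/-! ## The main theorem -/

/-- The function `t ↦ ⟨a + t⟩`. -/
def angleMap (ι : algebraicClosure ℚ ℂ →+* ℂ_[p]) (a : ℂ_[p]) : C(ℤ_[p], ℂ_[p]) :=
  ⟨fun t => angle ι a + toC t / omegaV ι a,
    continuous_const.add (continuous_toC.div_const _)⟩

theorem angleMap_apply (ι : algebraicClosure ℚ ℂ →+* ℂ_[p]) {a : ℂ_[p]} (ha : 1 < ‖a‖)
    (t : ℤ_[p]) : angleMap ι a t = angle ι (a + toC t) :=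
  (angle_add ι ha (norm_toC_le_one t)).symm

theorem norm_angleMap_sub_one_le (ι : algebraicClosure ℚ ℂ →+* ℂ_[p]) {a : ℂ_[p]} (ha : a ≠ 0)
    (t : ℤ_[p]) : ‖angleMap ι a t - 1‖ ≤ max ‖angle ι a - 1‖ ‖a⁻¹‖ := by
  have h : angleMap ι a t - 1 = angle ι a - 1 + toC t / omegaV ι a := by
    change angle ι a + toC t / omegaV ι a - 1 = _
    ring
  rw [h]
  refine (IsUltrametricDist.norm_add_le_max _ _).trans (max_le_max le_rfl ?_)
  rw [norm_div, norm_omegaV ι ha, norm_inv, ← one_div]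
  gcongr
  exact norm_toC_le_one t

end PadicVanGorder
end

open PadicVanGorder

theorem mainTheorem1 {p : ℕ} [Fact p.Prime] (hodd : p ≠ 2)
    (ι : algebraicClosure ℚ ℂ →+* ℂ_[p]) (a : ℂ_[p]) (ha : 1 < ‖a‖) :
    (∀ s : ℤ_[p], HasFermionicIntegral (fun t => anglePow ι (a + toC t) (1 - toC s))
      (zetaE ι (toC s) a)) ∧
    ∃ F : C(ℤ_[p], ℂ_[p]),
      (∀ s : ℤ_[p], F s = zetaE ι (toC s) a - anglePow ι a (1 - toC s)) ∧
      ContDiffOn ℚ_[p] ((⊤ : ℕ∞) : WithTop ℕ∞) (extendZero F) (Metric.closedBall 0 1) ∧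
      (∀ s : ℤ_[p], ∃ m : ℕ, ∀ t : ℤ_[p], (p : ℤ_[p]) ^ m ∣ t →
        HasSum (expDTerm t F s) (expD t F s)) ∧
      (∀ K : IntermediateField ℚ_[p] ℂ_[p], FiniteDimensional ℚ_[p] K →
        ramificationIndex K < p - 1 → a ∈ K →
        ∀ (s : ℤ_[p]) (n : ℕ), HasSum (expDTerm (n : ℤ_[p]) F s) (expD (n : ℤ_[p]) F s)) ∧
      ∀ s : ℤ_[p], s ≠ 1 →
        Summable (fun n : ℕ => opL ι a n F s) ∧
        opT ι a F s =
          1 / (toC s - 1) * (anglePow ι (a - 1) (1 - toC s) - anglePow ι a (1 - toC s)) := by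
  have ha0 : a ≠ 0 := norm_pos_iff.mp (one_pos.trans ha)
  have ha1 : ‖a⁻¹‖ < 1 := by rw [norm_inv]; exact inv_lt_one_of_one_lt₀ ha
  have hρ : max ‖angle ι a - 1‖ ‖a⁻¹‖ < 1 := max_lt (norm_angle_sub_one_lt ι ha0) ha1
  have hx := norm_angleMap_sub_one_le ι ha0
  have hxa := angleMap_apply ι ha
  set x := angleMap ι a
  have hpow : ∀ s t : ℤ_[p],
      anglePow ι (a + toC t) (1 - toC s) = binomMap x hρ hx (1 - s) t := fun s t => by
    have h : (1 - toC s : ℂ_[p]) = toC (1 - s) := by rw [toC_sub, toC_one]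
    rw [h, anglePow_toC, ← hxa]
    rfl
  have hpow0 : ∀ s : ℤ_[p], anglePow ι a (1 - toC s) = binomPow (x 0) (1 - s) := fun s => by
    have h := hpow s 0
    rwa [toC_zero, add_zero] at h
  have hpow1 : ∀ s : ℤ_[p], anglePow ι (a - 1) (1 - toC s) = binomPow (x (-1)) (1 - s) :=
    fun s => by
      have h := hpow s (-1)
      rwa [toC_neg, toC_one, ← sub_eq_add_neg] at h
  have hzeta : ∀ s : ℤ_[p], zetaE ι (toC s) a = fermionicIntegral (binomMap x hρ hx (1 - s)) :=
    fun s => by simp only [zetaE, hpow]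
  have htaylor := fun (m : ℕ) (ρ' : ℝ) (hρ' : ρ' * expRadiusInv p < 1) =>
    exists_hasSum_pow_zetaSub x hρ hx hodd (m := m) hρ'
  obtain ⟨m, ρ', hρ', hxm⟩ := exists_norm_pow_prime_pow_sub_one_le x hx hρ
  refine ⟨fun s => ?_, zetaSub x hρ hx hodd, fun s => ?_, ?_, fun s => ⟨m, fun t ht => ?_⟩, ?_,
    fun s hs => ?_⟩
  · rw [hzeta]
    simp only [hpow]
    exact hasFermionicIntegral hodd _
  · rw [zetaSub_apply, hzeta, hpow0, fermionicCLM_apply]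
  · exact contDiffOn_extendZero (fun s => ⟨m, htaylor m ρ' hρ' hxm s⟩) _
  · obtain ⟨e, he, hf⟩ := htaylor m ρ' hρ' hxm s
    rw [expD_apply]
    exact hasSum_expDTerm he hf ht
  · intro K hfin hK haK s n
    have hρK : max ‖angle ι a - 1‖ ‖a⁻¹‖ * expRadiusInv p < 1 := by
      rcases max_choice ‖angle ι a - 1‖ ‖a⁻¹‖ with h | h <;> rw [h]
      · exact norm_angle_sub_one_mul_expRadiusInv_lt_one ι hK haK ha0
      · exact norm_mul_expRadiusInv_lt_one hK (inv_mem haK) ha1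
    -- With `m = 0` the condition `p^m ∣ t` is empty, so every integer `n` is admitted.
    obtain ⟨e, he, hf⟩ := htaylor 0 _ hρK (by simpa using hx) s
    rw [expD_apply]
    exact hasSum_expDTerm he hf (by simp)
  · have h := hasSum_opL_zetaSub ι a hodd ha x hρ hx hxa hs
    refine ⟨h.summable, ?_⟩
    rw [opT, h.tsum_eq, hpow0, hpow1]
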